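/- Let $q\in(0,1)$. Let $U_q\mathfrak{sl}_2$ be the complex algebra with generators $K,K^{-1},E,F$ and relations $KK^{-1}=K^{-1}K=1$, $K^{\pm1}E=q^{\pm2}EK^{\pm1}$, $K^{\pm1}F=q^{\mp2}FK^{\pm1}$, $EF-FE=(K-K^{-1})/(q-q^{-1})$, with the coproduct $\Delta(K^{\pm1})=K^{\pm1}\otimes K^{\pm1}$, $\Delta(E)=E\otimes1+K\otimes E$, $\Delta(F)=F\otimes K^{-1}+1\otimes F$ and the counit $\varepsilon(E)=\varepsilon(F)=0$, $\varepsilon(K^{\pm1})=1$; let $U_q\mathfrak b_+$ be its subalgebra generated by $K,K^{-1},E$. An invariant integral on a $U_q\mathfrak{sl}_2$-module $V$ is a linear functional $\eta:V\to\mathbb C$ with $\eta(av)=\varepsilon(a)\eta(v)$ for all $a\in U_q\mathfrak{sl}_2$, $v\in V$. Let $\mathrm{Pol}(\mathbb C)_q$ be the unital complex algebra generated by $z,z^*$ with the relation $z^*z=q^2zz^*+1-q^2$; the monomials $z^jz^{*k}$ form a basis of it. It is a covariant algebra ($a\cdot1=\varepsilon(a)1$, and the multiplication is a morphism of $U_q\mathfrak{sl}_2$-modules)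 for the action determined by $$K^{\pm1}z=q^{\pm2}z,\quad Ez=-q^{1/2}z^2,\quad Fz=q^{1/2},\qquad K^{\pm1}z^*=q^{\mp2}z^*,\quad Ez^*=q^{-3/2},\quad Fz^*=-q^{5/2}z^{*2}.$$ Let $D(U)_q'$ be the space of formal series $f=\sum_{j,k\ge0}a_{jk}z^jz^{*k}$ with the topology of coefficientwise convergence. The $\mathrm{Pol}(\mathbb C)_q$-bimodule structure and the $U_q\mathfrak{sl}_2$-action extend to $D(U)_q'$ by continuity. The space of finite functions in the quantum disc is $$D(U)_q=\{f\in D(U)_q'\;:\;z^{*N}f=fz^N=0\text{ for some }N\in\mathbb N\}.$$ It is a $U_q\mathfrak{sl}_2$-submodule, and an algebra with the product $fg=\sum_{j,k}a_{jk}z^j(z^{*k}g)$ for $f=\sum a_{jk}z^jz^{*k}$. Let $\widetilde H=\{f\in D(U)_q: fz=0\}$; it is stable under $U_q\mathfrak b_+$ and under left multiplication by $D(U)_q$. Denote by $\widetilde\Gamma$ and $\widetilde T$ the resulting representations of $U_q\mathfrak b_+$ and $D(U)_q$ in $\widetilde H$. **Theorem.** (1) For every $f\in D(U)_q$ the operator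 $\widetilde T(f)\widetilde\Gamma(K^{-1})$ on $\widetilde H$ has finite rank, and $$\eta(f)=\mathrm{tr}\bigl(\widetilde T(f)\widetilde\Gamma(K^{-1})\bigr)$$ is an invariant integral on $D(U)_q$. (2) Put $y=1-zz^*$. For a function $\psi$ on $\{q^{2n}:n\ge0\}$ let $\psi(y)\in D(U)_q'$ be the unique series $\sum_k c_kz^kz^{*k}$ such that $\sum_{k} c_k\prod_{i<k}(1-q^{-2i}q^{2n})=\psi(q^{2n})$ for all $n\ge0$ (note that $z^kz^{*k}=\prod_{i<k}(1-q^{-2i}y)$, and that the terms with $k>n$ vanish). Every $f\in D(U)_q$ has a unique decomposition $$f=\sum_{j>0}z^j\psi_j(y)+\psi_0(y)+\sum_{j>0}\psi_{-j}(y)z^{*j}$$ with functions $\psi_j$ on $\{q^{2n}:n\ge0\}$, $j\in\mathbb Z$, that have only finitely many nonzero values in total. The linear functional $$\int_{U_q}f\,d\nu=(1-q^2)\sum_{n=0}^\infty\psi_0(q^{2n})q^{-2n}$$ is a nonzero scalar multiple of $\eta$, and hence is an invariant integral on $D(U)_q$. -/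

import Mathlib

set_option linter.unusedSimpArgs false
set_option linter.unusedTactic false
set_option linter.unreachableTactic false

noncomputable section

namespace QDisc

/-- The deformation parameter `q ∈ (0,1)`, regarded as a complex number. -/
abbrev qc (q : Set.Ioo (0 : ℝ) 1) : ℂ := ((q : ℝ) : ℂ)

/-- The positive square root `q^{1/2}`, regarded as a complex number. -/
abbrev qh (q : Set.Ioo (0 : ℝ) 1) : ℂ := ((Real.sqrt (q : ℝ) : ℝ) : ℂ)

theorem qc_ne (q : Set.Ioo (0 : ℝ) 1) : qc q ≠ 0 := by
  simpa using q.2.1.ne'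

theorem qh_sq (q : Set.Ioo (0 : ℝ) 1) : qh q ^ 2 = qc q := by
  have := Real.sq_sqrt q.2.1.le
  simp only [qh, qc]
  exact_mod_cast this

theorem qh_ne (q : Set.Ioo (0 : ℝ) 1) : qh q ≠ 0 := by
  intro h
  have := qh_sq q
  rw [h] at this
  exact qc_ne q (by simpa using this.symm)

theorem qc_pow_ne_one (q : Set.Ioo (0 : ℝ) 1) {n : ℕ} (hn : n ≠ 0) : qc q ^ n ≠ 1 := by
  have := pow_lt_one₀ q.2.1.le q.2.2 hn
  simp only [qc]
  exact_mod_cast this.ne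

/-! ### The quantum universal enveloping algebra -/

/-- Names of the generators `K`, `K⁻¹`, `E`, `F`. -/
inductive UqGen
  | K
  | Kinv
  | E
  | F

open FreeAlgebra in
/-- The defining relations of `U_q sl₂`. -/
inductive UqRel (q : Set.Ioo (0 : ℝ) 1) : FreeAlgebra ℂ UqGen → FreeAlgebra ℂ UqGen → Prop
  | K_Kinv : UqRel q (ι ℂ UqGen.K * ι ℂ UqGen.Kinv) 1
  | Kinv_K : UqRel q (ι ℂ UqGen.Kinv * ι ℂ UqGen.K) 1
  | K_E : UqRel q (ι ℂ UqGen.K * ι ℂ UqGen.E) (qc q ^ 2 • (ι ℂ UqGen.E * ι ℂ UqGen.K))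
  | Kinv_E : UqRel q (ι ℂ UqGen.Kinv * ι ℂ UqGen.E)
      ((qc q ^ 2)⁻¹ • (ι ℂ UqGen.E * ι ℂ UqGen.Kinv))
  | K_F : UqRel q (ι ℂ UqGen.K * ι ℂ UqGen.F) ((qc q ^ 2)⁻¹ • (ι ℂ UqGen.F * ι ℂ UqGen.K))
  | Kinv_F : UqRel q (ι ℂ UqGen.Kinv * ι ℂ UqGen.F)
      (qc q ^ 2 • (ι ℂ UqGen.F * ι ℂ UqGen.Kinv))
  | E_F : UqRel q (ι ℂ UqGen.E * ι ℂ UqGen.F - ι ℂ UqGen.F * ι ℂ UqGen.E)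
      ((qc q - (qc q)⁻¹)⁻¹ • (ι ℂ UqGen.K - ι ℂ UqGen.Kinv))

/-- The complex algebra `U_q sl₂`, by generators and relations. -/
abbrev UqSl2 (q : Set.Ioo (0 : ℝ) 1) : Type := RingQuot (UqRel q)

/-- The generators as elements of `U_q sl₂`. -/
def gen (q : Set.Ioo (0 : ℝ) 1) (g : UqGen) : UqSl2 q :=
  RingQuot.mkAlgHom ℂ (UqRel q) (FreeAlgebra.ι ℂ g)

/-- The counit `ε` of `U_q sl₂`: `ε(E) = ε(F) = 0`, `ε(K^{±1}) = 1`. -/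
def counit (q : Set.Ioo (0 : ℝ) 1) : UqSl2 q →ₐ[ℂ] ℂ :=
  RingQuot.liftAlgHom ℂ ⟨FreeAlgebra.lift ℂ (fun g => match g with
    | UqGen.K => (1 : ℂ)
    | UqGen.Kinv => 1
    | UqGen.E => 0
    | UqGen.F => 0), by
      intro x y h
      cases h <;> simp⟩

/-- The subalgebra `U_q b₊` generated by `K`, `K⁻¹`, `E`. -/
def UqB (q : Set.Ioo (0 : ℝ) 1) : Subalgebra ℂ (UqSl2 q) :=
  Algebra.adjoin ℂ {gen q UqGen.K, gen q UqGen.Kinv, gen q UqGen.E}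

/-- `K⁻¹` as an element of `U_q b₊`. -/
def KinvB (q : Set.Ioo (0 : ℝ) 1) : UqB q :=
  ⟨gen q UqGen.Kinv, Algebra.subset_adjoin (by simp)⟩

/-- An invariant integral on a `U_q sl₂`-module `V` (given by its representation `ρ`): a morphism
of `U_q sl₂`-modules from `V` to the trivial module `ℂ`, on which `a` acts as `ε(a)`. -/
structure IsInvariantIntegral {q : Set.Ioo (0 : ℝ) 1} {V : Type*} [AddCommGroup V] [Module ℂ V]
    (ρ : UqSl2 q →ₐ[ℂ] Module.End ℂ V) (η : V → ℂ) : Prop where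
  linear : IsLinearMap ℂ η
  equivariant : ∀ (a : UqSl2 q) (v : V), η (ρ a v) = counit q a * η v

/-! ### Distributions in the quantum disc -/

/-- The space `D(U)_q'` of formal series `f = ∑ a_{jk} z^j z^{*k}`; `f j k` is `a_{jk}`. -/
abbrev Series : Type := ℕ → ℕ → ℂ

/-- The monomial `z^j z^{*k}`. -/
def mono (j k : ℕ) : Series := fun m n => if m = j ∧ n = k then 1 else 0

/-- Coefficients shifted in the first index: `∑ a_{jk} z^{j+1} z^{*k}`. -/
def upZ (f : Series) : Series := fun j k => match j with
  | 0 => 0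
  | j + 1 => f j k

/-- Coefficients shifted in the second index: `∑ a_{jk} z^j z^{*(k+1)}`. -/
def upS (f : Series) : Series := fun j k => match k with
  | 0 => 0
  | k + 1 => f j k

@[simp] theorem upZ_zero (f : Series) (k : ℕ) : upZ f 0 k = 0 := rfl
@[simp] theorem upZ_succ (f : Series) (j k : ℕ) : upZ f (j + 1) k = f j k := rfl
@[simp] theorem upS_zero (f : Series) (j : ℕ) : upS f j 0 = 0 := by cases j <;> rfl
@[simp] theorem upS_succ (f : Series) (j k : ℕ) : upS f j (k + 1) = f j k := by cases j <;> rfl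

/-- The left multiplication `f ↦ z f`. -/
def zL : Module.End ℂ Series where
  toFun f := upZ f
  map_add' f g := by ext j k; cases j <;> simp
  map_smul' c f := by ext j k; cases j <;> simp

/-- The right multiplication `f ↦ f z^*`. -/
def sR : Module.End ℂ Series where
  toFun f := upS f
  map_add' f g := by ext j k; cases k <;> simp
  map_smul' c f := by ext j k; cases k <;> simp

/-- The left multiplication `f ↦ z^* f`. By `z^* z = q² z z^* + 1 - q²` one has
`z^* z^j = q^{2j} z^j z^* + (1 - q^{2j}) z^{j-1}`. -/
def sL (q : Set.Ioo (0 : ℝ) 1) : Module.End ℂ Series where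
  toFun f := fun j k => qc q ^ (2 * j) * upS f j k + (1 - qc q ^ (2 * (j + 1))) * f (j + 1) k
  map_add' f g := by ext j k; cases k <;> simp <;> ring
  map_smul' c f := by ext j k; cases k <;> simp <;> ring

/-- The right multiplication `f ↦ f z`. By `z^* z = q² z z^* + 1 - q²` one has
`z^{*k} z = q^{2k} z z^{*k} + (1 - q^{2k}) z^{*(k-1)}`. -/
def zR (q : Set.Ioo (0 : ℝ) 1) : Module.End ℂ Series where
  toFun f := fun j k => qc q ^ (2 * k) * upZ f j k + (1 - qc q ^ (2 * (k + 1))) * f j (k + 1)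
  map_add' f g := by ext j k; cases j <;> simp <;> ring
  map_smul' c f := by ext j k; cases j <;> simp <;> ring

/-- `z^* (z f) = q² z (z^* f) + (1 - q²) f`. -/
theorem sL_zL (q : Set.Ioo (0 : ℝ) 1) (f : Series) :
    sL q (zL f) = qc q ^ 2 • zL (sL q f) + (1 - qc q ^ 2) • f := by
  ext j k
  rcases j with _ | j <;> rcases k with _ | k <;> simp [sL, zL] <;> ring

/-- `(f z^*) z = q² (f z) z^* + (1 - q²) f`. -/
theorem zR_sR (q : Set.Ioo (0 : ℝ) 1) (f : Series) :
    zR q (sR f) = qc q ^ 2 • sR (zR q f) + (1 - qc q ^ 2) • f := by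
  ext j k
  rcases j with _ | j <;> rcases k with _ | k <;> simp [zR, sR] <;> ring

/-- Left and right multiplications commute: `(z f) z = z (f z)`. -/
theorem zR_zL (q : Set.Ioo (0 : ℝ) 1) (f : Series) : zR q (zL f) = zL (zR q f) := by
  ext j k
  rcases j with _ | _ | j <;> simp [zR, zL]

/-- Left and right multiplications commute: `(z^* f) z = z^* (f z)`. -/
theorem zR_sL (q : Set.Ioo (0 : ℝ) 1) (f : Series) : zR q (sL q f) = sL q (zR q f) := by
  ext j k
  rcases j with _ | j <;> rcases k with _ | k <;> simp [zR, sL] <;> ring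

/-! ### The action of the generators -/

/-- `1 + x + ⋯ + x^{n-1}`. -/
def brk (x : ℂ) (n : ℕ) : ℂ := ∑ i ∈ Finset.range n, x ^ i

@[simp] theorem brk_zero (x : ℂ) : brk x 0 = 0 := by simp [brk]

theorem brk_succ (x : ℂ) (n : ℕ) : brk x (n + 1) = x * brk x n + 1 := by
  simp [brk, Finset.sum_range_succ', Finset.mul_sum, pow_succ']

theorem one_sub_ne (q : Set.Ioo (0 : ℝ) 1) : 1 - qc q ^ 2 ≠ 0 :=
  sub_ne_zero.2 (qc_pow_ne_one q two_ne_zero).symm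

theorem brk_pos (q : Set.Ioo (0 : ℝ) 1) (n : ℕ) :
    brk (qc q ^ 2) n = (1 - qc q ^ (2 * n)) / (1 - qc q ^ 2) := by
  have h := one_sub_ne q
  induction n with
  | zero => simp
  | succ n ih => rw [brk_succ, ih]; field_simp; ring

theorem brk_neg (q : Set.Ioo (0 : ℝ) 1) (n : ℕ) :
    brk ((qc q)⁻¹ ^ 2) n =
      (1 - qc q ^ (2 * n)) / (1 - qc q ^ 2) * qc q ^ 2 / qc q ^ (2 * n) := by
  have h := one_sub_ne q
  have h0 := qc_ne q
  induction n with
  | zero => simp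
  | succ n ih => rw [brk_succ, ih]; field_simp; ring

/-- The action of `K`: `K (z^j z^{*k}) = q^{2j-2k} z^j z^{*k}`. -/
def opK (q : Set.Ioo (0 : ℝ) 1) : Module.End ℂ Series where
  toFun f := fun j k => qc q ^ (2 * j) * ((qc q)⁻¹ ^ (2 * k)) * f j k
  map_add' f g := by ext j k; simp; ring
  map_smul' c f := by ext j k; simp; ring

/-- The action of `K⁻¹`: `K⁻¹ (z^j z^{*k}) = q^{2k-2j} z^j z^{*k}`. -/
def opKinv (q : Set.Ioo (0 : ℝ) 1) : Module.End ℂ Series where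
  toFun f := fun j k => (qc q)⁻¹ ^ (2 * j) * qc q ^ (2 * k) * f j k
  map_add' f g := by ext j k; simp; ring
  map_smul' c f := by ext j k; simp; ring

/-- The action of `E`. By `Δ(E) = E ⊗ 1 + K ⊗ E`, `Ez = -q^{1/2} z²`, `Ez^* = q^{-3/2}` one has
`E (z^j z^{*k}) = -q^{1/2} (∑_{i<j} q^{2i}) z^{j+1} z^{*k}
  + q^{2j-3/2} (∑_{i<k} q^{-2i}) z^j z^{*(k-1)}`. -/
def opE (q : Set.Ioo (0 : ℝ) 1) : Module.End ℂ Series where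
  toFun f := fun j k => -qh q * upZ (fun j k => brk (qc q ^ 2) j * f j k) j k
    + qc q ^ (2 * j) * (qh q ^ 3)⁻¹ * brk ((qc q)⁻¹ ^ 2) (k + 1) * f j (k + 1)
  map_add' f g := by ext j k; cases j <;> simp <;> ring
  map_smul' c f := by ext j k; cases j <;> simp <;> ring

/-- The action of `F`. By `Δ(F) = F ⊗ K⁻¹ + 1 ⊗ F`, `Fz = q^{1/2}`, `Fz^* = -q^{5/2} z^{*2}` one
has `F (z^j z^{*k}) = q^{1/2+2k} (∑_{i<j} q^{-2i}) z^{j-1} z^{*k}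
  - q^{5/2} (∑_{i<k} q^{2i}) z^j z^{*(k+1)}`. -/
def opF (q : Set.Ioo (0 : ℝ) 1) : Module.End ℂ Series where
  toFun f := fun j k => qh q * qc q ^ (2 * k) * brk ((qc q)⁻¹ ^ 2) (j + 1) * f (j + 1) k
    - qh q ^ 5 * upS (fun j k => brk (qc q ^ 2) k * f j k) j k
  map_add' f g := by ext j k; cases k <;> simp <;> ring
  map_smul' c f := by ext j k; cases k <;> simp <;> ring

/-- The unit is an invariant; with the covariance relations below this determines the action on
polynomials, hence, by continuity, on formal series. -/
theorem op_one (q : Set.Ioo (0 : ℝ) 1) : opK q (mono 0 0) = mono 0 0 ∧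
    opKinv q (mono 0 0) = mono 0 0 ∧ opE q (mono 0 0) = 0 ∧ opF q (mono 0 0) = 0 := by
  refine ⟨?_, ?_, ?_, ?_⟩ <;> ext j k <;> rcases j with _ | j <;> rcases k with _ | k <;>
    simp [opK, opKinv, opE, opF, mono] <;> intro h <;> simp [h]

/-- `K (z f) = (Kz) (Kf)`, `K (z^* f) = (Kz^*) (Kf)`. -/
theorem opK_zL (q : Set.Ioo (0 : ℝ) 1) (f : Series) :
    opK q (zL f) = qc q ^ 2 • zL (opK q f) := by
  ext j k
  rcases j with _ | j <;> simp [opK, zL]; ring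

theorem opK_sL (q : Set.Ioo (0 : ℝ) 1) (f : Series) :
    opK q (sL q f) = (qc q ^ 2)⁻¹ • sL q (opK q f) := by
  have := qc_ne q
  ext j k
  rcases k with _ | k <;> simp [opK, sL] <;> field_simp <;> ring

theorem opKinv_sL (q : Set.Ioo (0 : ℝ) 1) (f : Series) :
    opKinv q (sL q f) = qc q ^ 2 • sL q (opKinv q f) := by
  have := qc_ne q
  ext j k
  rcases k with _ | k <;> simp [opKinv, sL] <;> field_simp <;> ring

theorem opK_zR (q : Set.Ioo (0 : ℝ) 1) (f : Series) :
    opK q (zR q f) = qc q ^ 2 • zR q (opK q f) := by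
  have := qc_ne q
  ext j k
  rcases j with _ | j <;> simp [opK, zR] <;> field_simp <;> ring

theorem opKinv_zR (q : Set.Ioo (0 : ℝ) 1) (f : Series) :
    opKinv q (zR q f) = (qc q ^ 2)⁻¹ • zR q (opKinv q f) := by
  have := qc_ne q
  ext j k
  rcases j with _ | j <;> simp [opKinv, zR] <;> field_simp <;> ring

/-- `E (z f) = (Ez) f + (Kz) (Ef)`. -/
theorem opE_zL (q : Set.Ioo (0 : ℝ) 1) (f : Series) :
    opE q (zL f) = -qh q • zL (zL f) + qc q ^ 2 • zL (opE q f) := by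
  ext j k
  rcases j with _ | _ | j <;> simp [opE, zL, brk_succ] <;> ring

/-- `E (z^* f) = (Ez^*) f + (Kz^*) (Ef)`. -/
theorem opE_sL (q : Set.Ioo (0 : ℝ) 1) (f : Series) :
    opE q (sL q f) = (qh q ^ 3)⁻¹ • f + (qc q ^ 2)⁻¹ • sL q (opE q f) := by
  have h := one_sub_ne q
  have h1 := qh_ne q
  rw [← qh_sq, ← pow_mul] at h
  ext j k
  rcases j with _ | _ | j <;> rcases k with _ | _ | k <;>
    simp only [opE, opF, opK, opKinv, sL, zL, zR, brk_pos, brk_neg, LinearMap.coe_mk,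
      AddHom.coe_mk, Pi.add_apply, Pi.sub_apply, Pi.smul_apply, smul_eq_mul, upZ_zero, upZ_succ,
      upS_zero, upS_succ] <;>
    simp only [← qh_sq, inv_pow] <;> field_simp <;> ring

/-- `E (f z) = (Ef) z + (Kf) (Ez)`. -/
theorem opE_zR (q : Set.Ioo (0 : ℝ) 1) (f : Series) :
    opE q (zR q f) = zR q (opE q f) - qh q • zR q (zR q (opK q f)) := by
  have h := one_sub_ne q
  have h1 := qh_ne q
  rw [← qh_sq, ← pow_mul] at h
  ext j k
  rcases j with _ | _ | j <;> rcases k with _ | _ | k <;>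
    simp only [opE, opF, opK, opKinv, sL, zL, zR, brk_pos, brk_neg, LinearMap.coe_mk,
      AddHom.coe_mk, Pi.add_apply, Pi.sub_apply, Pi.smul_apply, smul_eq_mul, upZ_zero, upZ_succ,
      upS_zero, upS_succ] <;>
    simp only [← qh_sq, inv_pow] <;> field_simp <;> ring

/-- `F (z f) = (Fz) (K⁻¹f) + z (Ff)`. -/
theorem opF_zL (q : Set.Ioo (0 : ℝ) 1) (f : Series) :
    opF q (zL f) = qh q • opKinv q f + zL (opF q f) := by
  have h := one_sub_ne q
  have h1 := qh_ne q
  rw [← qh_sq, ← pow_mul] at h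
  ext j k
  rcases j with _ | _ | j <;> rcases k with _ | _ | k <;>
    simp only [opE, opF, opK, opKinv, sL, zL, zR, brk_pos, brk_neg, LinearMap.coe_mk,
      AddHom.coe_mk, Pi.add_apply, Pi.sub_apply, Pi.smul_apply, smul_eq_mul, upZ_zero, upZ_succ,
      upS_zero, upS_succ] <;>
    simp only [← qh_sq, inv_pow] <;> field_simp <;> ring

/-- `F (z^* f) = (Fz^*) (K⁻¹f) + z^* (Ff)`. -/
theorem opF_sL (q : Set.Ioo (0 : ℝ) 1) (f : Series) :
    opF q (sL q f) = -qh q ^ 5 • sL q (sL q (opKinv q f)) + sL q (opF q f) := by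
  have h := one_sub_ne q
  have h1 := qh_ne q
  rw [← qh_sq, ← pow_mul] at h
  ext j k
  rcases j with _ | _ | j <;> rcases k with _ | _ | k <;>
    simp only [opE, opF, opK, opKinv, sL, zL, zR, brk_pos, brk_neg, LinearMap.coe_mk,
      AddHom.coe_mk, Pi.add_apply, Pi.sub_apply, Pi.smul_apply, smul_eq_mul, upZ_zero, upZ_succ,
      upS_zero, upS_succ] <;>
    simp only [← qh_sq, inv_pow] <;> field_simp <;> ring

/-- `F (f z) = (Ff) (K⁻¹z) + f (Fz)`. -/
theorem opF_zR (q : Set.Ioo (0 : ℝ) 1) (f : Series) :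
    opF q (zR q f) = (qc q ^ 2)⁻¹ • zR q (opF q f) + qh q • f := by
  have h := one_sub_ne q
  have h1 := qh_ne q
  rw [← qh_sq, ← pow_mul] at h
  ext j k
  rcases j with _ | _ | j <;> rcases k with _ | _ | k <;>
    simp only [opE, opF, opK, opKinv, sL, zL, zR, brk_pos, brk_neg, LinearMap.coe_mk,
      AddHom.coe_mk, Pi.add_apply, Pi.sub_apply, Pi.smul_apply, smul_eq_mul, upZ_zero, upZ_succ,
      upS_zero, upS_succ] <;>
    simp only [← qh_sq, inv_pow] <;> field_simp <;> ring

/-- The relation `EF - FE = (K - K⁻¹)/(q - q⁻¹)` for the operators. -/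
theorem opE_opF (q : Set.Ioo (0 : ℝ) 1) (f : Series) : opE q (opF q f) - opF q (opE q f) =
    (qc q - (qc q)⁻¹)⁻¹ • (opK q f - opKinv q f) := by
  have h := one_sub_ne q
  have h1 := qc_ne q
  have h3 := qh_ne q
  have h2 : (qc q - (qc q)⁻¹)⁻¹ = - qc q / (1 - qc q ^ 2) := by
    rw [inv_eq_iff_eq_inv, inv_div]
    field_simp
    ring
  rw [h2]
  rw [← qh_sq, ← pow_mul] at h
  ext j k
  rcases j with _ | _ | j <;> rcases k with _ | _ | k <;>
    simp only [opE, opF, opK, opKinv, brk_pos, brk_neg, LinearMap.coe_mk,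
      AddHom.coe_mk, Pi.add_apply, Pi.sub_apply, Pi.smul_apply, smul_eq_mul, upZ_zero, upZ_succ,
      upS_zero, upS_succ] <;>
    simp only [← qh_sq, inv_pow, ← pow_mul] <;> field_simp <;> ring

/-! ### Finite functions -/

/-- Vectors killed by some power of `A`. -/
def nilSub (A : Module.End ℂ Series) : Submodule ℂ Series where
  carrier := {f | ∃ N : ℕ, (A ^ N) f = 0}
  zero_mem' := ⟨0, by simp⟩
  add_mem' := by
    rintro f g ⟨N, hN⟩ ⟨M, hM⟩
    refine ⟨N + M, ?_⟩
    have h1 : (A ^ (N + M)) g = 0 := by rw [pow_add, Module.End.mul_apply, hM, map_zero]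
    have h2 : (A ^ (N + M)) f = 0 := by
      rw [add_comm, pow_add, Module.End.mul_apply, hN, map_zero]
    rw [map_add, h1, h2, add_zero]
  smul_mem' := by
    rintro c f ⟨N, hN⟩
    exact ⟨N, by rw [map_smul, hN, smul_zero]⟩

theorem mem_nilSub {A : Module.End ℂ Series} {f : Series} :
    f ∈ nilSub A ↔ ∃ N : ℕ, (A ^ N) f = 0 := Iff.rfl

theorem pow_zero_of_le {A : Module.End ℂ Series} {f : Series} {N M : ℕ} (h : N ≤ M)
    (hN : (A ^ N) f = 0) : (A ^ M) f = 0 := by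
  obtain ⟨k, rfl⟩ := Nat.exists_eq_add_of_le' h
  rw [pow_add, Module.End.mul_apply, hN, map_zero]

theorem nilSub_apply_iff {A : Module.End ℂ Series} {f : Series} :
    A f ∈ nilSub A ↔ f ∈ nilSub A := by
  constructor
  · rintro ⟨N, hN⟩
    exact ⟨N + 1, by rw [pow_succ, Module.End.mul_apply, hN]⟩
  · rintro ⟨N, hN⟩
    exact ⟨N, by rw [← Module.End.mul_apply, ← pow_succ, pow_succ', Module.End.mul_apply, hN,
      map_zero]⟩

theorem nilSub_map {A T : Module.End ℂ Series} (c : ℂ) (R : Series → Series)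
    (h : ∀ f, A (T f) = c • T (A f) + R f) (hR : ∀ f ∈ nilSub A, R f ∈ nilSub A) :
    ∀ f ∈ nilSub A, T f ∈ nilSub A := by
  rintro f ⟨N, hN⟩
  induction N generalizing f with
  | zero =>
    have : f = 0 := by simpa using hN
    rw [this, map_zero]
    exact zero_mem _
  | succ N ih =>
    have hf : f ∈ nilSub A := ⟨_, hN⟩
    rw [pow_succ, Module.End.mul_apply] at hN
    rw [← nilSub_apply_iff, h]
    exact add_mem (Submodule.smul_mem _ _ (ih _ hN)) (hR f hf)

/-- The space `D(U)_q` of finite functions in the quantum disc: those `f` in `D(U)_q'` with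
`z^{*N} f = f z^N = 0` for some `N`. -/
def DU (q : Set.Ioo (0 : ℝ) 1) : Submodule ℂ Series where
  carrier := {f | ∃ N : ℕ, (sL q ^ N) f = 0 ∧ (zR q ^ N) f = 0}
  zero_mem' := ⟨0, by simp⟩
  add_mem' := by
    rintro f g ⟨N, hN, hN'⟩ ⟨M, hM, hM'⟩
    refine ⟨max N M, ?_, ?_⟩
    · rw [map_add, pow_zero_of_le (le_max_left _ _) hN, pow_zero_of_le (le_max_right _ _) hM,
        add_zero]
    · rw [map_add, pow_zero_of_le (le_max_left _ _) hN', pow_zero_of_le (le_max_right _ _) hM',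
        add_zero]
  smul_mem' := by
    rintro c f ⟨N, hN, hN'⟩
    exact ⟨N, by rw [map_smul, hN, smul_zero], by rw [map_smul, hN', smul_zero]⟩

theorem mem_DU {q : Set.Ioo (0 : ℝ) 1} {f : Series} :
    f ∈ DU q ↔ f ∈ nilSub (sL q) ∧ f ∈ nilSub (zR q) := by
  constructor
  · rintro ⟨N, h, h'⟩
    exact ⟨⟨N, h⟩, ⟨N, h'⟩⟩
  · rintro ⟨⟨N, h⟩, ⟨M, h'⟩⟩
    exact ⟨max N M, pow_zero_of_le (le_max_left _ _) h, pow_zero_of_le (le_max_right _ _) h'⟩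

theorem opK_mem (q : Set.Ioo (0 : ℝ) 1) : ∀ f ∈ DU q, opK q f ∈ DU q := by
  intro f hf
  rw [mem_DU] at hf ⊢
  have h0 := qc_ne q
  refine ⟨nilSub_map (qc q ^ 2) (fun _ => 0) (fun f => ?_) (fun _ _ => zero_mem _) f hf.1,
    nilSub_map (qc q ^ 2)⁻¹ (fun _ => 0) (fun f => ?_) (fun _ _ => zero_mem _) f hf.2⟩
  · rw [opK_sL, smul_smul, mul_inv_cancel₀ (by simpa using h0), one_smul, add_zero]
  · rw [opK_zR, smul_smul, inv_mul_cancel₀ (by simpa using h0), one_smul, add_zero]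

theorem opKinv_mem (q : Set.Ioo (0 : ℝ) 1) : ∀ f ∈ DU q, opKinv q f ∈ DU q := by
  intro f hf
  rw [mem_DU] at hf ⊢
  have h0 := qc_ne q
  refine ⟨nilSub_map (qc q ^ 2)⁻¹ (fun _ => 0) (fun f => ?_) (fun _ _ => zero_mem _) f hf.1,
    nilSub_map (qc q ^ 2) (fun _ => 0) (fun f => ?_) (fun _ _ => zero_mem _) f hf.2⟩
  · rw [opKinv_sL, smul_smul, inv_mul_cancel₀ (by simpa using h0), one_smul, add_zero]
  · rw [opKinv_zR, smul_smul, mul_inv_cancel₀ (by simpa using h0), one_smul, add_zero]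

theorem opK_nil_zR (q : Set.Ioo (0 : ℝ) 1) : ∀ f ∈ nilSub (zR q), opK q f ∈ nilSub (zR q) := by
  have h0 := qc_ne q
  refine nilSub_map (qc q ^ 2)⁻¹ (fun _ => 0) (fun f => ?_) (fun _ _ => zero_mem _)
  rw [opK_zR, smul_smul, inv_mul_cancel₀ (by simpa using h0), one_smul, add_zero]

theorem opKinv_nil_sL (q : Set.Ioo (0 : ℝ) 1) :
    ∀ f ∈ nilSub (sL q), opKinv q f ∈ nilSub (sL q) := by
  have h0 := qc_ne q
  refine nilSub_map (qc q ^ 2)⁻¹ (fun _ => 0) (fun f => ?_) (fun _ _ => zero_mem _)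
  rw [opKinv_sL, smul_smul, inv_mul_cancel₀ (by simpa using h0), one_smul, add_zero]

theorem opE_mem (q : Set.Ioo (0 : ℝ) 1) : ∀ f ∈ DU q, opE q f ∈ DU q := by
  intro f hf
  rw [mem_DU] at hf ⊢
  have h0 : qc q ^ 2 ≠ 0 := pow_ne_zero _ (qc_ne q)
  refine ⟨nilSub_map (qc q ^ 2) (fun f => -(qc q ^ 2 * (qh q ^ 3)⁻¹) • f) (fun f => ?_)
      (fun _ h => Submodule.smul_mem _ _ h) f hf.1,
    nilSub_map 1 (fun f => qh q • zR q (zR q (opK q f))) (fun f => ?_)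
      (fun f h => Submodule.smul_mem _ _ (nilSub_apply_iff.2 (nilSub_apply_iff.2
        (opK_nil_zR q f h)))) f hf.2⟩
  · rw [opE_sL, smul_add, smul_smul, smul_smul, mul_inv_cancel₀ h0]
    module
  · rw [opE_zR]; module

theorem opF_mem (q : Set.Ioo (0 : ℝ) 1) : ∀ f ∈ DU q, opF q f ∈ DU q := by
  intro f hf
  rw [mem_DU] at hf ⊢
  have h0 : qc q ^ 2 ≠ 0 := pow_ne_zero _ (qc_ne q)
  refine ⟨nilSub_map 1 (fun f => qh q ^ 5 • sL q (sL q (opKinv q f))) (fun f => ?_)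
      (fun f h => Submodule.smul_mem _ _ (nilSub_apply_iff.2 (nilSub_apply_iff.2
        (opKinv_nil_sL q f h)))) f hf.1,
    nilSub_map (qc q ^ 2) (fun f => -(qc q ^ 2 * qh q) • f) (fun f => ?_)
      (fun _ h => Submodule.smul_mem _ _ h) f hf.2⟩
  · rw [opF_sL]; module
  · rw [opF_zR, smul_add, smul_smul, smul_smul, mul_inv_cancel₀ h0]
    module

/-- The action of the generators on `D(U)_q`. -/
def genDU (q : Set.Ioo (0 : ℝ) 1) : UqGen → Module.End ℂ (DU q)
  | UqGen.K => (opK q).restrict (opK_mem q)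
  | UqGen.Kinv => (opKinv q).restrict (opKinv_mem q)
  | UqGen.E => (opE q).restrict (opE_mem q)
  | UqGen.F => (opF q).restrict (opF_mem q)

/-- The representation of `U_q sl₂` in `D(U)_q`. -/
def actDU (q : Set.Ioo (0 : ℝ) 1) : UqSl2 q →ₐ[ℂ] Module.End ℂ (DU q) :=
  RingQuot.liftAlgHom ℂ ⟨FreeAlgebra.lift ℂ (genDU q), by
    have h0 := qc_ne q
    intro x y h
    cases h with
    | E_F =>
      simp only [map_mul, map_sub, map_smul, FreeAlgebra.lift_ι_apply, genDU]
      refine LinearMap.ext fun f => Subtype.ext ?_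
      exact opE_opF q f
    | _ =>
      simp only [map_mul, map_smul, map_one, FreeAlgebra.lift_ι_apply, genDU]
      refine LinearMap.ext fun f => Subtype.ext ?_
      ext j k
      rcases j with _ | j <;> rcases k with _ | k <;>
      simp [opK, opKinv, opE, opF] <;> field_simp <;> ring⟩

theorem actDU_gen (q : Set.Ioo (0 : ℝ) 1) (g : UqGen) : actDU q (gen q g) = genDU q g := by
  simp [actDU, gen]

/-! ### The product of finite functions -/

/-- Left multiplication by the power series `∑ a_i z^i`. -/
def cv (a : ℕ → ℂ) : Module.End ℂ Series where
  toFun g := fun m n => ∑ p ∈ Finset.HasAntidiagonal.antidiagonal m, a p.1 * g p.2 n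
  map_add' f g := by ext m n; simp [mul_add, Finset.sum_add_distrib]
  map_smul' c f := by
    ext m n
    simp only [Pi.smul_apply, smul_eq_mul, RingHom.id_apply, Finset.mul_sum]
    exact Finset.sum_congr rfl fun _ _ => by ring

theorem cv_zero (g : Series) : cv 0 g = 0 := by ext m n; simp [cv]

theorem cv_add (a b : ℕ → ℂ) (g : Series) : cv (a + b) g = cv a g + cv b g := by
  ext m n; simp [cv, add_mul, Finset.sum_add_distrib]

theorem zR_cv (q : Set.Ioo (0 : ℝ) 1) (a : ℕ → ℂ) (g : Series) :
    zR q (cv a g) = cv a (zR q g) := by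
  ext m n
  rcases m with _ | m
  · simp [zR, cv]; ring
  · simp only [zR, cv, LinearMap.coe_mk, AddHom.coe_mk, upZ_succ, mul_add,
      Finset.sum_add_distrib]
    congr 1
    · rw [Finset.Nat.sum_antidiagonal_succ', Finset.mul_sum]
      simp only [upZ_zero, upZ_succ, mul_zero, zero_add, add_zero]
      exact Finset.sum_congr rfl fun _ _ => by ring
    · rw [Finset.mul_sum]
      exact Finset.sum_congr rfl fun _ _ => by ring

theorem sL_cv (q : Set.Ioo (0 : ℝ) 1) (a : ℕ → ℂ) (g : Series) :
    sL q (cv a g) = cv (fun i => qc q ^ (2 * i) * a i) (sL q g) +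
      cv (fun i => (1 - qc q ^ (2 * (i + 1))) * a (i + 1)) g := by
  ext m n
  have key : (1 - qc q ^ (2 * (m + 1))) * cv a g (m + 1) n =
      ∑ p ∈ Finset.HasAntidiagonal.antidiagonal m,
        qc q ^ (2 * p.1) * a p.1 * ((1 - qc q ^ (2 * (p.2 + 1))) * g (p.2 + 1) n) +
      ∑ p ∈ Finset.HasAntidiagonal.antidiagonal m, (1 - qc q ^ (2 * (p.1 + 1))) * a (p.1 + 1) * g p.2 n := by
    have e1 := Finset.Nat.sum_antidiagonal_succ' (n := m)
      (f := fun p : ℕ × ℕ => qc q ^ (2 * p.1) * a p.1 * ((1 - qc q ^ (2 * p.2)) * g p.2 n))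
    have e2 := Finset.Nat.sum_antidiagonal_succ (n := m)
      (f := fun p : ℕ × ℕ => (1 - qc q ^ (2 * p.1)) * a p.1 * g p.2 n)
    simp only [mul_zero, pow_zero, sub_self, zero_mul, add_zero, zero_add] at e1 e2
    rw [← e1, ← e2, ← Finset.sum_add_distrib]
    simp only [cv, LinearMap.coe_mk, AddHom.coe_mk, Finset.mul_sum]
    refine Finset.sum_congr rfl fun p hp => ?_
    rw [← Finset.HasAntidiagonal.mem_antidiagonal.1 hp, mul_add, pow_add]
    ring
  have key2 : qc q ^ (2 * m) * upS (cv a g) m n = ∑ p ∈ Finset.HasAntidiagonal.antidiagonal m,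
      qc q ^ (2 * p.1) * a p.1 * (qc q ^ (2 * p.2) * upS g p.2 n) := by
    rcases n with _ | n
    · simp
    · simp only [upS_succ, cv, LinearMap.coe_mk, AddHom.coe_mk, Finset.mul_sum]
      refine Finset.sum_congr rfl fun p hp => ?_
      rw [← Finset.HasAntidiagonal.mem_antidiagonal.1 hp, mul_add, pow_add]
      ring
  have e : sL q (cv a g) m n = qc q ^ (2 * m) * upS (cv a g) m n +
    (1 - qc q ^ (2 * (m + 1))) * cv a g (m + 1) n := rfl
  rw [e, key, key2, ← add_assoc, ← Finset.sum_add_distrib]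
  simp only [cv, sL, LinearMap.coe_mk, AddHom.coe_mk, Pi.add_apply]
  congr 1
  exact Finset.sum_congr rfl fun p _ => by ring

/-- The product `f g = ∑_{j,k} a_{jk} z^j (z^{*k} g)` of a distribution `f = ∑ a_{jk} z^j z^{*k}`
and a finite function `g`: the extension by continuity in `f` of the left multiplication by
polynomials. Only finitely many `k` contribute, as `z^{*N} g = 0` for some `N`. -/
def mulS (q : Set.Ioo (0 : ℝ) 1) (f g : Series) : Series :=
  ∑ᶠ k : ℕ, cv (fun j => f j k) ((sL q ^ k) g)

theorem mulS_eq (q : Set.Ioo (0 : ℝ) 1) (f g : Series) {N : ℕ} (h : (sL q ^ N) g = 0) :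
    mulS q f g = ∑ k ∈ Finset.range N, cv (fun j => f j k) ((sL q ^ k) g) := by
  refine finsum_eq_sum_of_support_subset _ fun k hk => ?_
  by_contra hN
  simp only [Finset.coe_range, Set.mem_Iio, not_lt] at hN
  exact hk (by simp only; rw [pow_zero_of_le hN h, map_zero])

theorem mulS_add (q : Set.Ioo (0 : ℝ) 1) (f : Series) {g g' : Series} (hg : g ∈ nilSub (sL q))
    (hg' : g' ∈ nilSub (sL q)) : mulS q f (g + g') = mulS q f g + mulS q f g' := by
  obtain ⟨N, hN⟩ := hg
  obtain ⟨M, hM⟩ := hg'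
  have h1 := pow_zero_of_le (le_max_left N M) hN
  have h2 := pow_zero_of_le (le_max_right N M) hM
  rw [mulS_eq q f g h1, mulS_eq q f g' h2,
    mulS_eq q f (g + g') (N := max N M) (by rw [map_add, h1, h2, add_zero]),
    ← Finset.sum_add_distrib]
  simp

theorem mulS_smul (q : Set.Ioo (0 : ℝ) 1) (f : Series) (c : ℂ) {g : Series}
    (hg : g ∈ nilSub (sL q)) : mulS q f (c • g) = c • mulS q f g := by
  obtain ⟨N, hN⟩ := hg
  rw [mulS_eq q f g hN, mulS_eq q f (c • g) (N := N) (by rw [map_smul, hN, smul_zero]),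
    Finset.smul_sum]
  simp

theorem zR_sL_pow (q : Set.Ioo (0 : ℝ) 1) (k : ℕ) (g : Series) :
    zR q ((sL q ^ k) g) = (sL q ^ k) (zR q g) := by
  induction k with
  | zero => simp
  | succ k ih => rw [pow_succ', Module.End.mul_apply, Module.End.mul_apply, zR_sL, ih]

/-- `(f g) z = f (g z)`. -/
theorem zR_mulS (q : Set.Ioo (0 : ℝ) 1) (f : Series) {g : Series} (hg : g ∈ nilSub (sL q)) :
    zR q (mulS q f g) = mulS q f (zR q g) := by
  obtain ⟨N, hN⟩ := hg
  rw [mulS_eq q f g hN, mulS_eq q f (zR q g) (N := N) (by rw [← zR_sL_pow, hN, map_zero]),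
    map_sum]
  exact Finset.sum_congr rfl fun k _ => by rw [zR_cv, zR_sL_pow]

/-- `z^* (f g) = (z^* f) g`. -/
theorem sL_mulS (q : Set.Ioo (0 : ℝ) 1) (f : Series) {g : Series} (hg : g ∈ nilSub (sL q)) :
    sL q (mulS q f g) = mulS q (sL q f) g := by
  obtain ⟨N, hN⟩ := hg
  have hN1 := pow_zero_of_le (Nat.le_succ N) hN
  rw [mulS_eq q f g hN, mulS_eq q (sL q f) g hN1, map_sum]
  have e : ∀ k, cv (fun j => sL q f j k) ((sL q ^ k) g) =
      cv (fun j => qc q ^ (2 * j) * upS f j k) ((sL q ^ k) g) +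
      cv (fun j => (1 - qc q ^ (2 * (j + 1))) * f (j + 1) k) ((sL q ^ k) g) := by
    intro k
    rw [← cv_add]
    rfl
  simp only [e, Finset.sum_add_distrib, sL_cv]
  congr 1
  · rw [Finset.sum_range_succ']
    have : (fun j => qc q ^ (2 * j) * upS f j 0) = 0 := by ext j; simp
    rw [this, cv_zero, add_zero]
    exact Finset.sum_congr rfl fun k _ => by
      rw [pow_succ', Module.End.mul_apply]; simp
  · rw [Finset.sum_range_succ, hN, map_zero, add_zero]

theorem mulS_mem (q : Set.Ioo (0 : ℝ) 1) {f g : Series} (hf : f ∈ DU q) (hg : g ∈ DU q) :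
    mulS q f g ∈ DU q := by
  have hgL := (mem_DU.1 hg).1
  rw [mem_DU]
  constructor
  · obtain ⟨N, hN⟩ := (mem_DU.1 hf).1
    refine ⟨N, ?_⟩
    have : ∀ (N : ℕ) (f : Series), (sL q ^ N) (mulS q f g) = mulS q ((sL q ^ N) f) g := by
      intro N
      induction N with
      | zero => simp
      | succ N ih => intro f; rw [pow_succ, Module.End.mul_apply, sL_mulS q f hgL, ih]; rfl
    rw [this, hN]
    have : (fun k : ℕ => cv (fun j => (0 : Series) j k) ((sL q ^ k) g)) = fun _ => 0 :=
      funext fun k => cv_zero _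
    rw [mulS, this, finsum_zero]
  · obtain ⟨N, hN⟩ := (mem_DU.1 hg).2
    refine ⟨N, ?_⟩
    have : ∀ (N : ℕ) (g : Series), g ∈ nilSub (sL q) →
        (zR q ^ N) (mulS q f g) = mulS q f ((zR q ^ N) g) := by
      intro N
      induction N with
      | zero => simp
      | succ N ih =>
        intro g hg
        have : zR q g ∈ nilSub (sL q) := by
          obtain ⟨M, hM⟩ := hg
          exact ⟨M, by rw [← zR_sL_pow, hM, map_zero]⟩
        rw [pow_succ, Module.End.mul_apply, zR_mulS q f hg, ih _ this]; rfl
    rw [this N g hgL, hN]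
    simp [mulS]

/-- The product of the algebra `D(U)_q`. -/
instance instMulDU (q : Set.Ioo (0 : ℝ) 1) : Mul (DU q) :=
  ⟨fun f g => ⟨mulS q f g, mulS_mem q f.2 g.2⟩⟩

/-! ### The representations in `H̃` and the functional `η` -/

/-- `H̃ = {f ∈ D(U)_q | f z = 0}`. -/
def Htilde (q : Set.Ioo (0 : ℝ) 1) : Submodule ℂ Series :=
  DU q ⊓ LinearMap.ker (zR q)

/-- The inclusion `H̃ ⊆ D(U)_q`. -/
def inclH (q : Set.Ioo (0 : ℝ) 1) : Htilde q →ₗ[ℂ] DU q :=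
  Submodule.inclusion inf_le_left

theorem zR_inclH (q : Set.Ioo (0 : ℝ) 1) (h : Htilde q) : zR q (inclH q h : Series) = 0 := h.2.2

/-- The representation `T̃` of `D(U)_q` in `H̃`: `T̃(f) h = f h`. -/
def Ttilde (q : Set.Ioo (0 : ℝ) 1) (f : DU q) : Module.End ℂ (Htilde q) where
  toFun h := ⟨(f * inclH q h : DU q), (f * inclH q h : DU q).2, by
    change zR q (mulS q f (inclH q h)) = 0
    rw [zR_mulS q f (mem_DU.1 (inclH q h).2).1, zR_inclH]
    simp [mulS]⟩
  map_add' h h' := Subtype.ext <|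
    mulS_add q f (mem_DU.1 (inclH q h).2).1 (mem_DU.1 (inclH q h').2).1
  map_smul' c h := Subtype.ext <| mulS_smul q f c (mem_DU.1 (inclH q h).2).1

theorem zR_act (q : Set.Ioo (0 : ℝ) 1) (a : UqSl2 q) (ha : a ∈ UqB q) :
    ∀ h : DU q, zR q (h : Series) = 0 → zR q (actDU q a h : Series) = 0 := by
  have h0 : qc q ^ 2 ≠ 0 := pow_ne_zero _ (qc_ne q)
  have hK : ∀ f : Series, zR q f = 0 → zR q (opK q f) = 0 := by
    intro f hf
    have := opK_zR q f
    rw [hf, map_zero] at this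
    exact ((smul_eq_zero.1 this.symm).resolve_left h0)
  induction ha using Algebra.adjoin_induction with
  | mem x hx =>
    intro h hh
    rcases hx with rfl | rfl | rfl
    · rw [actDU_gen]
      exact hK _ hh
    · rw [actDU_gen]
      have := opKinv_zR q h
      rw [hh, map_zero] at this
      exact ((smul_eq_zero.1 this.symm).resolve_left (inv_ne_zero h0))
    · rw [actDU_gen]
      have := opE_zR q h
      rw [hh, hK _ hh, map_zero, map_zero, smul_zero, sub_zero] at this
      exact this.symm
  | algebraMap r =>
    intro h hh
    rw [AlgHom.commutes]
    change zR q (r • (h : Series)) = 0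
    rw [map_smul, hh, smul_zero]
  | add x y _ _ hx hy =>
    intro h hh
    rw [map_add]
    change zR q ((actDU q x h : Series) + (actDU q y h : Series)) = 0
    rw [map_add, hx h hh, hy h hh, add_zero]
  | mul x y _ _ hx hy =>
    intro h hh
    rw [map_mul]
    exact hx _ (hy h hh)

/-- The representation `Γ̃` of `U_q b₊` in `H̃`, the restriction of the action on `D(U)_q`. -/
def Gtilde (q : Set.Ioo (0 : ℝ) 1) : UqB q →ₐ[ℂ] Module.End ℂ (Htilde q) where
  toFun a :=
    { toFun := fun h => ⟨actDU q a (inclH q h), (actDU q a (inclH q h)).2,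
        zR_act q a a.2 _ (zR_inclH q h)⟩
      map_add' := fun h h' => Subtype.ext (by simp)
      map_smul' := fun c h => Subtype.ext (by simp) }
  map_one' := by
    refine LinearMap.ext fun h => Subtype.ext ?_
    simp
    rfl
  map_mul' a b := by
    refine LinearMap.ext fun h => Subtype.ext ?_
    simp
    rfl
  map_zero' := by
    refine LinearMap.ext fun h => Subtype.ext ?_
    simp
  map_add' a b := by
    refine LinearMap.ext fun h => Subtype.ext ?_
    simp
  commutes' r := by
    refine LinearMap.ext fun h => Subtype.ext ?_
    simp
    rfl

/-- The trace of a linear operator `L` of finite rank in a (possibly infinite-dimensional) space: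
the trace of the restriction of `L` to its finite-dimensional image. -/
def finTrace {V : Type*} [AddCommGroup V] [Module ℂ V] (L : Module.End ℂ V) : ℂ :=
  LinearMap.trace ℂ (LinearMap.range L)
    (L.restrict (p := LinearMap.range L) (q := LinearMap.range L)
      fun v _ => LinearMap.mem_range_self L v)

/-- The functional `η(f) = tr(T̃(f) Γ̃(K⁻¹))`. -/
def eta (q : Set.Ioo (0 : ℝ) 1) (f : DU q) : ℂ :=
  finTrace (Ttilde q f * Gtilde q (KinvB q))

/-! ### The integral over the quantum disc -/

/-- The polynomial `z^k z^{*k} = ∏_{i<k} (1 - q^{-2i} y)` in `y = 1 - z z^*`, evaluated at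
`y = q^{2n}`. It vanishes for `k > n`. -/
def zzVal (q : Set.Ioo (0 : ℝ) 1) (k n : ℕ) : ℂ :=
  ∏ i ∈ Finset.range k, (1 - (qc q)⁻¹ ^ (2 * i) * qc q ^ (2 * n))

theorem zL_mono (j k : ℕ) : zL (mono j k) = mono (j + 1) k := by
  ext m n
  rcases m with _ | m <;> simp [zL, mono]

theorem sL_mono_zero (q : Set.Ioo (0 : ℝ) 1) (k : ℕ) :
    sL q (mono 0 k) = mono 0 (k + 1) := by
  ext m n
  rcases m with _ | m <;> rcases n with _ | n <;> simp [sL, mono]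

theorem sL_mono_succ (q : Set.Ioo (0 : ℝ) 1) (j k : ℕ) :
    sL q (mono (j + 1) k) = qc q ^ (2 * (j + 1)) • mono (j + 1) (k + 1) +
      (1 - qc q ^ (2 * (j + 1))) • mono j k := by
  ext m n
  by_cases h1 : m = j
  · subst h1
    rcases n with _ | n <;> simp [sL, mono]
  · by_cases h2 : m = j + 1
    · subst h2
      rcases n with _ | n <;> simp [sL, mono]
    · rcases n with _ | n <;> simp [sL, mono, h1, h2]

/-- `z^{k+1} z^{*(k+1)} = (1 - q^{-2k} y) z^k z^{*k}`. -/
theorem mono_succ (q : Set.Ioo (0 : ℝ) 1) (k : ℕ) : mono (k + 1) (k + 1) =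
    mono k k - (qc q)⁻¹ ^ (2 * k) • (mono k k - zL (sL q (mono k k))) := by
  have h0 : qc q ^ (2 * k) ≠ 0 := pow_ne_zero _ (qc_ne q)
  rcases k with _ | k
  · simp [sL_mono_zero, zL_mono]
  · rw [sL_mono_succ, map_add, map_smul, map_smul, zL_mono, zL_mono]
    have : mono (k + 1) (k + 1) - (qc q ^ (2 * (k + 1)) • mono (k + 1 + 1) (k + 1 + 1) +
        (1 - qc q ^ (2 * (k + 1))) • mono (k + 1) (k + 1)) = qc q ^ (2 * (k + 1)) •
        (mono (k + 1) (k + 1) - mono (k + 1 + 1) (k + 1 + 1)) := by module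
    rw [this, smul_smul, inv_pow, inv_mul_cancel₀ h0, one_smul, sub_sub_cancel]

theorem zzVal_self_ne (q : Set.Ioo (0 : ℝ) 1) (n : ℕ) : zzVal q n n ≠ 0 := by
  refine Finset.prod_ne_zero_iff.2 fun i hi => ?_
  have hi := Finset.mem_range.1 hi
  have h0 := qc_ne q
  have : (qc q)⁻¹ ^ (2 * i) * qc q ^ (2 * n) = qc q ^ (2 * (n - i)) := by
    rw [show 2 * n = 2 * i + 2 * (n - i) by omega, pow_add, ← mul_assoc, ← mul_pow,
      inv_mul_cancel₀ h0, one_pow, one_mul]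
  rw [this]
  exact sub_ne_zero.2 (qc_pow_ne_one q (by omega)).symm

/-- The coefficients `c_k` of the series `ψ(y) = ∑ c_k z^k z^{*k}`, where `ψ` is a function on
`{q^{2n}}`, written as `φ n = ψ(q^{2n})`. They are determined by
`∑_k c_k (z^k z^{*k})(q^{2n}) = ψ(q^{2n})`. -/
def yCoeff (q : Set.Ioo (0 : ℝ) 1) (φ : ℕ → ℂ) (n : ℕ) : ℂ :=
  (φ n - ∑ k : Fin n, yCoeff q φ k * zzVal q k n) / zzVal q n n
termination_by n
decreasing_by exact k.2

theorem yCoeff_spec (q : Set.Ioo (0 : ℝ) 1) (φ : ℕ → ℂ) (n : ℕ) :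
    ∑ k ∈ Finset.range (n + 1), yCoeff q φ k * zzVal q k n = φ n := by
  rw [Finset.sum_range_succ, yCoeff, div_mul_cancel₀ _ (zzVal_self_ne q n),
    Finset.sum_range (fun k => yCoeff q φ k * zzVal q k n)]
  ring

/-- The distribution `ψ(y)`, `y = 1 - z z^*`, for a function `ψ` on `{q^{2n} | n ≥ 0}`, written as
`φ n = ψ(q^{2n})`. -/
def funY (q : Set.Ioo (0 : ℝ) 1) (φ : ℕ → ℂ) : Series :=
  fun j k => if j = k then yCoeff q φ k else 0

/-- The sum `∑_{j>0} z^j ψ_j(y) + ψ_0(y) + ∑_{j>0} ψ_{-j}(y) z^{*j}` for a family of functions on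
`{q^{2n}}` with finitely many nonzero values in total; `ψ j n` is `ψ_j(q^{2n})`. -/
def ofParts (q : Set.Ioo (0 : ℝ) 1) (ψ : ℤ →₀ ℕ →₀ ℂ) : Series :=
  ∑ j ∈ ψ.support, if 0 ≤ j then (zL ^ j.toNat) (funY q (ψ j)) else (sR ^ (-j).toNat) (funY q (ψ j))

open Classical in
/-- The components `ψ_j` of `f`. -/
def parts (q : Set.Ioo (0 : ℝ) 1) (f : Series) : ℤ →₀ ℕ →₀ ℂ :=
  if h : ∃ ψ, f = ofParts q ψ then h.choose else 0

/-- The integral `∫_{U_q} f dν = (1 - q²) ∑_n ψ_0(q^{2n}) q^{-2n}`. -/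
def nuIntegral (q : Set.Ioo (0 : ℝ) 1) (f : DU q) : ℂ :=
  (1 - qc q ^ 2) * (parts q f 0).sum fun n c => c * (qc q)⁻¹ ^ (2 * n)

end QDisc

end

open QDisc

noncomputable section

namespace QDisc

/-! ### Vacuum projection and matrix units -/

/-! The equations `z^* f₀ = f₀ z = 0` have, up to scalars, a single solution in formal series, the
vacuum `f₀` (`eq_smul_vac`). The elements `e_{mn} = z^m f₀ z^{*n}` behave like matrix units. Left
multiplication by `z^*` and right multiplication by `z` lower `m` and `n` with the factors `1 -
q^{2m}` and `1 - q^{2n}`, which vanish only at index zero. Hence the `e_{mn}` span `D(U)_q`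
(`mem_span_matUnit`), and every claim about linear functionals reduces to them.

On `H̃`, where the vectors `z^m f₀` live, `f₀` acts by `g ↦ g₀₀ f₀`. So `e_{mn}` acts with rank at
most one and with image in the line of `z^m f₀`, on which `K⁻¹` is the scalar `q^{-2m}`. This gives
`η(e_{mn}) = δ_{mn} (1-q²)⋯(1-q^{2m}) q^{-2m}` (`eta_unitDU`). The operators `K^{±1}` are diagonal
in the `e_{mn}`, while `E` and `F` each produce two neighbours of `e_{mn}`. Invariance is then one
scalar identity per generator.

For part (2), `e_{mm}` is a function of `y` supported at the single point `q^{2m}`, with value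
`(1-q²)⋯(1-q^{2m})` there. This is the vanishing of alternating sums of Gaussian binomials
(`yCoeff_single`). For `m ≠ n` the component `ψ_0` of `e_{mn}` is zero. Thus `∫ f dν` and `(1-q²)
η(f)` agree on all `e_{mn}`. Uniqueness of the decomposition is a triangularity argument along each
diagonal `j - k`. -/

theorem one_sub_pow_ne (q : Set.Ioo (0 : ℝ) 1) (n : ℕ) : 1 - qc q ^ (2 * (n + 1)) ≠ 0 :=
  sub_ne_zero.2 (qc_pow_ne_one q (by omega)).symm

/-- The coefficients of the vacuum projection. -/
def vacCoeff (q : Set.Ioo (0 : ℝ) 1) : ℕ → ℂ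
  | 0 => 1
  | k + 1 => -(qc q ^ (2 * k) / (1 - qc q ^ (2 * (k + 1)))) * vacCoeff q k

/-- The vacuum projection, the element `f₀` of `D(U)_q` with `z^* f₀ = f₀ z = 0`. -/
def vac (q : Set.Ioo (0 : ℝ) 1) : Series := fun j k => if j = k then vacCoeff q k else 0

/-- The matrix units `z^m f₀ z^{*n}`, up to normalization. -/
def matUnit (q : Set.Ioo (0 : ℝ) 1) (m n : ℕ) : Series := (sR ^ n) ((zL ^ m) (vac q))

/-- `(1 - q²)(1 - q⁴) ⋯ (1 - q^{2n})`. -/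
def qfac (q : Set.Ioo (0 : ℝ) 1) (n : ℕ) : ℂ := ∏ i ∈ Finset.range n, (1 - qc q ^ (2 * (i + 1)))

theorem qfac_succ (q : Set.Ioo (0 : ℝ) 1) (n : ℕ) :
    qfac q (n + 1) = qfac q n * (1 - qc q ^ (2 * (n + 1))) := Finset.prod_range_succ _ _

/-! ### Compatibility of the operators with `f ↦ z f` and `f ↦ f z^*` -/

theorem sR_zL (f : Series) : sR (zL f) = zL (sR f) := by
  ext j k
  rcases j with _ | j <;> rcases k with _ | k <;> simp [sR, zL]

theorem sL_sR (q : Set.Ioo (0 : ℝ) 1) (f : Series) : sL q (sR f) = sR (sL q f) := by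
  ext j k
  rcases k with _ | _ | k <;> simp [sL, sR]

theorem opK_sR (q : Set.Ioo (0 : ℝ) 1) (f : Series) :
    opK q (sR f) = (qc q ^ 2)⁻¹ • sR (opK q f) := by
  have := qc_ne q
  ext j k
  rcases k with _ | k <;> simp [opK, sR]; field_simp; ring

theorem opKinv_zL (q : Set.Ioo (0 : ℝ) 1) (f : Series) :
    opKinv q (zL f) = (qc q ^ 2)⁻¹ • zL (opKinv q f) := by
  have := qc_ne q
  ext j k
  rcases j with _ | j <;> simp [opKinv, zL]; field_simp; ring

theorem opKinv_sR (q : Set.Ioo (0 : ℝ) 1) (f : Series) :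
    opKinv q (sR f) = qc q ^ 2 • sR (opKinv q f) := by
  ext j k
  rcases k with _ | k <;> simp [opKinv, sR]; ring

theorem opE_sR (q : Set.Ioo (0 : ℝ) 1) (f : Series) :
    opE q (sR f) = sR (opE q f) + (qh q ^ 3)⁻¹ • opK q f := by
  have h := one_sub_ne q
  have h1 := qh_ne q
  rw [← qh_sq, ← pow_mul] at h
  ext j k
  rcases j with _ | _ | j <;> rcases k with _ | _ | k <;>
    simp only [opE, opK, sR, brk_pos, brk_neg, LinearMap.coe_mk,
      AddHom.coe_mk, Pi.add_apply, Pi.smul_apply, smul_eq_mul, upZ_zero, upZ_succ,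
      upS_zero, upS_succ] <;>
    simp only [← qh_sq, inv_pow] <;> field_simp <;> ring

theorem opF_sR (q : Set.Ioo (0 : ℝ) 1) (f : Series) :
    opF q (sR f) = qc q ^ 2 • sR (opF q f) - qh q ^ 5 • sR (sR f) := by
  ext j k
  rcases k with _ | _ | k <;> simp [opF, sR, brk_succ] <;> ring

/-! ### The equations that characterize the vacuum -/

theorem sL_vac (q : Set.Ioo (0 : ℝ) 1) : sL q (vac q) = 0 := by
  ext j k
  rcases k with _ | k
  · simp [sL, vac]
  · by_cases h : j = k
    · subst h
      have := one_sub_pow_ne q j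
      simp only [sL, vac, vacCoeff, LinearMap.coe_mk, AddHom.coe_mk, upS_succ, if_true,
        Pi.zero_apply]
      field_simp
      ring
    · simp [sL, vac, h]

theorem zR_vac (q : Set.Ioo (0 : ℝ) 1) : zR q (vac q) = 0 := by
  ext j k
  rcases j with _ | j
  · simp [zR, vac]
  · by_cases h : j = k
    · subst h
      have := one_sub_pow_ne q j
      simp only [zR, vac, vacCoeff, LinearMap.coe_mk, AddHom.coe_mk, upZ_succ, if_true,
        Pi.zero_apply]
      field_simp
      ring
    · simp [zR, vac, h]

theorem vac_zero_zero (q : Set.Ioo (0 : ℝ) 1) : vac q 0 0 = 1 := by simp [vac, vacCoeff]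

/-- Up to scalars, the vacuum projection is the only solution of `z^* f = f z = 0`. -/
theorem eq_smul_vac (q : Set.Ioo (0 : ℝ) 1) {g : Series} (h : sL q g = 0) (h' : zR q g = 0) :
    g = g 0 0 • vac q := by
  -- The row `j = 0` of `g z = 0` leaves only `g 0 0` in the first row. The recursion `h2`, which is
  -- `z^* g = 0`, then determines each row from the previous one.
  have h1 : ∀ k, g 0 (k + 1) = 0 := by
    intro k
    have := congrFun (congrFun h' 0) k
    simpa [zR, one_sub_pow_ne q k] using this
  have h2 : ∀ j k, g (j + 1) k =
      -(qc q ^ (2 * j) / (1 - qc q ^ (2 * (j + 1)))) * upS g j k := by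
    intro j k
    have := congrFun (congrFun h j) k
    have h0 := one_sub_pow_ne q j
    simp only [sL, LinearMap.coe_mk, AddHom.coe_mk, Pi.zero_apply] at this
    field_simp
    linear_combination this
  ext j k
  induction j generalizing k with
  | zero => rcases k with _ | k <;> simp [vac, vacCoeff, h1]
  | succ j ih =>
    rw [h2]
    rcases k with _ | k
    · simp [vac]
    · rw [upS_succ, ih]
      by_cases hjk : j = k
      · subst hjk
        simp [vac, vacCoeff]
        ring
      · simp [vac, hjk]

theorem matUnit_zero_zero (q : Set.Ioo (0 : ℝ) 1) : matUnit q 0 0 = vac q := rfl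

theorem sR_matUnit (q : Set.Ioo (0 : ℝ) 1) (m n : ℕ) :
    sR (matUnit q m n) = matUnit q m (n + 1) := by
  rw [matUnit, matUnit, pow_succ', Module.End.mul_apply]

theorem zL_matUnit (q : Set.Ioo (0 : ℝ) 1) (m n : ℕ) :
    zL (matUnit q m n) = matUnit q (m + 1) n := by
  induction n with
  | zero => simp [matUnit, pow_succ']
  | succ n ih => rw [← sR_matUnit, ← sR_zL, ih, sR_matUnit]

/-- Attaching all left factors `z` first keeps `n = 0` in the step on `m`, where the terms coming
from the right factors vanish. Each formula below then costs one commutation relation per step. -/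
theorem matUnit_induction {p : ℕ → ℕ → Prop} (h0 : p 0 0) (hz : ∀ m, p m 0 → p (m + 1) 0)
    (hs : ∀ m n, p m n → p m (n + 1)) (m n : ℕ) : p m n := by
  induction n with
  | zero =>
    induction m with
    | zero => exact h0
    | succ m ih => exact hz m ih
  | succ n ih => exact hs m n ih

/-- Moving `z^*` through `z^m` by `z^* z = q² z z^* + 1 - q²` accumulates `1 - q^{2m}`, and `z^* f₀
= 0` ends the process. At `m = 0` the coefficient vanishes, so the truncated `m - 1` is harmless. -/
theorem sL_matUnit (q : Set.Ioo (0 : ℝ) 1) (m n : ℕ) :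
    sL q (matUnit q m n) = (1 - qc q ^ (2 * m)) • matUnit q (m - 1) n := by
  induction m, n using matUnit_induction with
  | h0 => simp [matUnit_zero_zero, sL_vac]
  | hz m ih =>
    rw [← zL_matUnit, sL_zL, ih]
    rcases m with _ | m
    · simp
    · rw [map_smul, zL_matUnit, Nat.add_sub_cancel, Nat.add_sub_cancel, smul_smul, ← add_smul]
      congr 1
      ring
  | hs m n ih => rw [← sR_matUnit, sL_sR, ih, map_smul, sR_matUnit]

theorem zR_matUnit (q : Set.Ioo (0 : ℝ) 1) (m n : ℕ) :
    zR q (matUnit q m n) = (1 - qc q ^ (2 * n)) • matUnit q m (n - 1) := by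
  induction m, n using matUnit_induction with
  | h0 => simp [matUnit_zero_zero, zR_vac]
  | hz m ih => rw [← zL_matUnit, zR_zL, ih]; simp
  | hs m n ih =>
    rw [← sR_matUnit, zR_sR, ih]
    rcases n with _ | n
    · simp
    · rw [map_smul, sR_matUnit, Nat.add_sub_cancel, Nat.add_sub_cancel, smul_smul, ← add_smul]
      congr 1
      ring

/-! ### The action of the generators on matrix units -/

theorem opK_matUnit (q : Set.Ioo (0 : ℝ) 1) (m n : ℕ) :
    opK q (matUnit q m n) = (qc q ^ (2 * m) * (qc q)⁻¹ ^ (2 * n)) • matUnit q m n := by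
  have h := qc_ne q
  induction m, n using matUnit_induction with
  | h0 =>
    rw [matUnit_zero_zero]
    ext j k
    by_cases hjk : j = k
    · subst hjk; simp [opK, vac, h]
    · simp [opK, vac, hjk]
  | hz m ih =>
    rw [← zL_matUnit, opK_zL, ih, map_smul, smul_smul]
    congr 1
    ring
  | hs m n ih =>
    rw [← sR_matUnit, opK_sR, ih, map_smul, smul_smul]
    congr 1
    ring

theorem opKinv_matUnit (q : Set.Ioo (0 : ℝ) 1) (m n : ℕ) :
    opKinv q (matUnit q m n) = ((qc q)⁻¹ ^ (2 * m) * qc q ^ (2 * n)) • matUnit q m n := by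
  have h := qc_ne q
  induction m, n using matUnit_induction with
  | h0 =>
    rw [matUnit_zero_zero]
    ext j k
    by_cases hjk : j = k
    · subst hjk; simp [opKinv, vac, h]
    · simp [opKinv, vac, hjk]
  | hz m ih =>
    rw [← zL_matUnit, opKinv_zL, ih, map_smul, smul_smul]
    congr 1
    ring
  | hs m n ih =>
    rw [← sR_matUnit, opKinv_sR, ih, map_smul, smul_smul]
    congr 1
    ring

/-- Applying `E` to `z^* f₀ = 0` and `f₀ z = 0` determines `z^* (E f₀)` and `(E f₀) z`. After
subtraction of the right multiple of `z f₀` both vanish, so the rest is a multiple of `f₀`. That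
multiple is zero because the constant coefficient is. -/
theorem opE_vac (q : Set.Ioo (0 : ℝ) 1) :
    opE q (vac q) = -(qh q / (1 - qc q ^ 2)) • matUnit q 1 0 := by
  have h := one_sub_ne q
  have h1 := qh_ne q
  have h2 := qc_ne q
  have hK : opK q (vac q) = vac q := by
    simpa [matUnit_zero_zero] using opK_matUnit q 0 0
  -- The constant is `q² · q^{-3/2} = q^{1/2}`, from the relation `opE_sL`.
  have hs : sL q (opE q (vac q)) = -qh q • vac q := by
    have := opE_sL q (vac q)
    rw [sL_vac, map_zero] at this
    have h3 : sL q (opE q (vac q)) = -(qc q ^ 2 * (qh q ^ 3)⁻¹) • vac q := by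
      rw [neg_smul, mul_smul, ← smul_neg, neg_eq_of_add_eq_zero_right this.symm, smul_smul,
        mul_inv_cancel₀ (pow_ne_zero 2 h2), one_smul]
    rw [h3, ← qh_sq]
    congr 2
    field_simp
  have key := eq_smul_vac q (g := opE q (vac q) + (qh q / (1 - qc q ^ 2)) • matUnit q 1 0)
    (by
      rw [map_add, map_smul, sL_matUnit, hs, smul_smul]
      simp only [matUnit_zero_zero, ← add_smul, mul_one, Nat.sub_self]
      rw [div_mul_cancel₀ _ h, neg_add_cancel, zero_smul])
    (by
      have := opE_zR q (vac q)
      rw [hK, zR_vac, map_zero, map_zero, smul_zero, sub_zero] at this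
      rw [map_add, map_smul, zR_matUnit, ← this]
      simp)
  have h0 : (opE q (vac q) + (qh q / (1 - qc q ^ 2)) • matUnit q 1 0) 0 0 = 0 := by
    simp [opE, matUnit, vac, zL]
  rw [h0, zero_smul] at key
  rw [eq_neg_of_add_eq_zero_left key, neg_smul]

/-- The mirror image of `opE_vac`: here `f₀ z = 0` produces the constant `q² · q^{1/2} = q^{5/2}`,
and `z^* (F f₀) = 0`. -/
theorem opF_vac (q : Set.Ioo (0 : ℝ) 1) :
    opF q (vac q) = -(qh q ^ 5 / (1 - qc q ^ 2)) • matUnit q 0 1 := by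
  have h := one_sub_ne q
  have h1 := qh_ne q
  have h2 := qc_ne q
  have hK : opKinv q (vac q) = vac q := by
    simpa [matUnit_zero_zero] using opKinv_matUnit q 0 0
  have hs : zR q (opF q (vac q)) = -qh q ^ 5 • vac q := by
    have := opF_zR q (vac q)
    rw [zR_vac, map_zero] at this
    have h3 : zR q (opF q (vac q)) = -(qc q ^ 2 * qh q) • vac q := by
      rw [neg_smul, mul_smul, ← smul_neg, neg_eq_of_add_eq_zero_left this.symm, smul_smul,
        mul_inv_cancel₀ (pow_ne_zero 2 h2), one_smul]
    rw [h3, ← qh_sq]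
    congr 1
    ring
  have key := eq_smul_vac q (g := opF q (vac q) + (qh q ^ 5 / (1 - qc q ^ 2)) • matUnit q 0 1)
    (by
      have := opF_sL q (vac q)
      rw [hK, sL_vac, map_zero, map_zero, smul_zero, zero_add] at this
      rw [map_add, map_smul, sL_matUnit, ← this]
      simp)
    (by
      rw [map_add, map_smul, zR_matUnit, hs, smul_smul]
      simp only [matUnit_zero_zero, ← add_smul, mul_one, Nat.sub_self]
      rw [div_mul_cancel₀ _ h, neg_add_cancel, zero_smul])
  have h0 : (opF q (vac q) + (qh q ^ 5 / (1 - qc q ^ 2)) • matUnit q 0 1) 0 0 = 0 := by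
    simp [opF, matUnit, vac, sR]
  rw [h0, zero_smul] at key
  rw [eq_neg_of_add_eq_zero_left key, neg_smul]

/-- The first coefficient does not depend on `m` because `-q^{1/2}/(1-q²)` is the fixed point of `c
↦ -q^{1/2} + q² c`, the effect of one more left factor `z`. The second is a geometric sum with one
term for each factor `z^*`. -/
theorem opE_matUnit (q : Set.Ioo (0 : ℝ) 1) (m n : ℕ) :
    opE q (matUnit q m n) = -(qh q / (1 - qc q ^ 2)) • matUnit q (m + 1) n +
      ((qh q ^ 3)⁻¹ * qc q ^ (2 * m) * brk ((qc q)⁻¹ ^ 2) n) • matUnit q m (n - 1) := by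
  have h := one_sub_ne q
  induction m, n using matUnit_induction with
  | h0 => simp [matUnit_zero_zero, opE_vac]
  | hz m ih =>
    rw [← zL_matUnit, opE_zL, ih]
    simp only [brk_zero, mul_zero, zero_smul, add_zero, map_smul, zL_matUnit, smul_smul,
      ← add_smul]
    congr 1
    field_simp
    ring
  | hs m n ih =>
    rw [← sR_matUnit, opE_sR, ih, opK_matUnit, map_add, map_smul, map_smul, sR_matUnit, add_assoc]
    congr 1
    rcases n with _ | n
    · simp [brk, smul_smul]
    · rw [sR_matUnit, Nat.add_sub_cancel, Nat.add_sub_cancel, smul_smul, ← add_smul]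
      congr 1
      rw [brk, brk, Finset.sum_range_succ _ (n + 1), ← pow_mul]
      ring

/-- The roles of the two sides are exchanged, so the factors `z^*` are attached first, with `m = 0`.
The first coefficient is the fixed point of `c ↦ q² c - q^{5/2}`. -/
theorem opF_matUnit (q : Set.Ioo (0 : ℝ) 1) (m n : ℕ) :
    opF q (matUnit q m n) = -(qh q ^ 5 / (1 - qc q ^ 2)) • matUnit q m (n + 1) +
      (qh q * qc q ^ (2 * n) * brk ((qc q)⁻¹ ^ 2) m) • matUnit q (m - 1) n := by
  have h := one_sub_ne q
  induction m generalizing n with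
  | zero =>
    induction n with
    | zero => simp [matUnit_zero_zero, opF_vac]
    | succ n ih =>
      rw [← sR_matUnit, opF_sR, ih]
      simp only [brk_zero, mul_zero, zero_smul, add_zero, map_smul, sR_matUnit, smul_smul,
        ← sub_smul]
      congr 1
      field_simp
      ring
  | succ m ih =>
    rw [← zL_matUnit, opF_zL, ih, opKinv_matUnit, map_add, map_smul, map_smul, zL_matUnit,
      add_left_comm]
    congr 1
    rcases m with _ | m
    · rw [smul_smul]
      simp [brk]
    · rw [zL_matUnit, Nat.add_sub_cancel, Nat.add_sub_cancel, smul_smul, ← add_smul]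
      congr 1
      rw [brk, brk, Finset.sum_range_succ _ (m + 1), ← pow_mul]
      ring

/-! ### The matrix units span the finite functions -/

theorem matUnit_mem (q : Set.Ioo (0 : ℝ) 1) (m n : ℕ) : matUnit q m n ∈ DU q := by
  rw [mem_DU]
  constructor
  · induction m with
    | zero => exact ⟨1, by simp [sL_matUnit]⟩
    | succ m ih =>
      rw [← nilSub_apply_iff, sL_matUnit]
      exact Submodule.smul_mem _ _ ih
  · induction n with
    | zero => exact ⟨1, by simp [zR_matUnit]⟩
    | succ n ih =>
      rw [← nilSub_apply_iff, zR_matUnit]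
      exact Submodule.smul_mem _ _ ih

/-- Right multiplication by `z` maps the span of the `e_{0n}` onto itself. By induction `f z` lies
in this span, so `f z = g z` for some `g` in it; then `f - g` is killed from both sides and is a
multiple of `f₀`. -/
theorem mem_span_of_sL_eq_zero (q : Set.Ioo (0 : ℝ) 1) {M : ℕ} {f : Series} (h : sL q f = 0)
    (h' : (zR q ^ M) f = 0) : f ∈ Submodule.span ℂ (Set.range fun n => matUnit q 0 n) := by
  induction M generalizing f with
  | zero =>
    have : f = 0 := by simpa using h'
    rw [this]
    exact zero_mem _
  | succ M ih =>
    have hz := ih (f := zR q f) (by rw [← zR_sL, h, map_zero])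
      (by rwa [pow_succ, Module.End.mul_apply] at h')
    have hle : Submodule.span ℂ (Set.range fun n => matUnit q 0 n) ≤
        (Submodule.span ℂ (Set.range fun n => matUnit q 0 n) ⊓ LinearMap.ker (sL q)).map
          (zR q) := by
      rw [Submodule.span_le]
      rintro _ ⟨n, rfl⟩
      refine ⟨(1 - qc q ^ (2 * (n + 1)))⁻¹ • matUnit q 0 (n + 1), ⟨Submodule.smul_mem _ _
        (Submodule.subset_span ⟨n + 1, rfl⟩), ?_⟩, ?_⟩
      · simp [sL_matUnit]
      · rw [map_smul, zR_matUnit, inv_smul_smul₀ (one_sub_pow_ne q n)]; rfl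
    obtain ⟨g, ⟨hg, hg'⟩, hgf⟩ := hle hz
    have hg' : sL q g = 0 := hg'
    have := eq_smul_vac q (g := f - g) (by rw [map_sub, h, hg', sub_zero])
      (by rw [map_sub, hgf, sub_self])
    rw [← sub_add_cancel f g, this]
    exact add_mem (Submodule.smul_mem _ _ (Submodule.subset_span ⟨0, rfl⟩)) hg

/-- The same lifting argument for left multiplication by `z^*`, whose kernel is handled by
`mem_span_of_sL_eq_zero`. -/
theorem mem_span_matUnit (q : Set.Ioo (0 : ℝ) 1) {f : Series} (h : f ∈ DU q) :
    f ∈ Submodule.span ℂ (Set.range fun p : ℕ × ℕ => matUnit q p.1 p.2) := by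
  obtain ⟨⟨N, hN⟩, M, hM⟩ := mem_DU.1 h
  clear h
  induction N generalizing f with
  | zero =>
    have : f = 0 := by simpa using hN
    rw [this]
    exact zero_mem _
  | succ N ih =>
    set S := Submodule.span ℂ (Set.range fun p : ℕ × ℕ => matUnit q p.1 p.2) with hS
    have hcomm : ∀ M : ℕ, ∀ f, (zR q ^ M) (sL q f) = sL q ((zR q ^ M) f) := by
      intro M
      induction M with
      | zero => simp
      | succ M ih => intro f; rw [pow_succ, Module.End.mul_apply, zR_sL, ih]; rfl
    have hz := ih (f := sL q f) (by rwa [pow_succ, Module.End.mul_apply] at hN)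
      (by rw [hcomm, hM, map_zero])
    -- The lift must stay nilpotent under right multiplication by `z`, so that `f - g` satisfies the
    -- hypothesis of the kernel lemma.
    have hle : S ≤ (S ⊓ nilSub (zR q)).map (sL q) := by
      rw [hS, Submodule.span_le]
      rintro _ ⟨⟨m, n⟩, rfl⟩
      refine ⟨(1 - qc q ^ (2 * (m + 1)))⁻¹ • matUnit q (m + 1) n, ⟨Submodule.smul_mem _ _
        (Submodule.subset_span ⟨(m + 1, n), rfl⟩), Submodule.smul_mem _ _
        (mem_DU.1 (matUnit_mem q _ _)).2⟩, ?_⟩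
      rw [map_smul, sL_matUnit, inv_smul_smul₀ (one_sub_pow_ne q m)]; rfl
    obtain ⟨g, ⟨hg, hg'⟩, hgf⟩ := hle hz
    obtain ⟨M', hM'⟩ := Submodule.sub_mem (nilSub (zR q)) (mem_nilSub.2 ⟨M, hM⟩) hg'
    have := mem_span_of_sL_eq_zero q (f := f - g) (by rw [map_sub, hgf, sub_self]) hM'
    rw [← sub_add_cancel f g]
    refine add_mem (Submodule.span_mono ?_ this) hg
    rintro _ ⟨n, rfl⟩
    exact ⟨(0, n), rfl⟩

/-- The matrix units as elements of `D(U)_q`. -/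
def unitDU (q : Set.Ioo (0 : ℝ) 1) (m n : ℕ) : DU q := ⟨matUnit q m n, matUnit_mem q m n⟩

theorem DU_induction (q : Set.Ioo (0 : ℝ) 1) {p : DU q → Prop} (hu : ∀ m n, p (unitDU q m n))
    (h0 : p 0) (ha : ∀ f g, p f → p g → p (f + g)) (hc : ∀ (c : ℂ) f, p f → p (c • f))
    (f : DU q) : p f := by
  obtain ⟨f, hf⟩ := f
  have := mem_span_matUnit q hf
  have key : ∃ h : f ∈ DU q, p ⟨f, h⟩ := by
    clear hf
    induction this using Submodule.span_induction with
    | mem x hx =>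
      obtain ⟨⟨m, n⟩, rfl⟩ := hx
      exact ⟨matUnit_mem q m n, hu m n⟩
    | zero => exact ⟨zero_mem _, h0⟩
    | add x y _ _ hx hy =>
      obtain ⟨hx, hx'⟩ := hx
      obtain ⟨hy, hy'⟩ := hy
      exact ⟨add_mem hx hy, ha _ _ hx' hy'⟩
    | smul c x _ hx =>
      obtain ⟨hx, hx'⟩ := hx
      exact ⟨Submodule.smul_mem _ c hx, hc c _ hx'⟩
  exact key.2

/-! ### The trace of operators of finite rank -/

section Trace

variable {V : Type*} [AddCommGroup V] [Module ℂ V]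

/-- This is `tr(AB) = tr(BA)` for the inclusion of the range into `W` and the map `W → range L`
given by `L`. It allows operators with different ranges to be compared on a common `W`, whence
additivity. -/
theorem finTrace_eq_trace_restrict (L : Module.End ℂ V) (W : Submodule ℂ V)
    [FiniteDimensional ℂ W] (h : LinearMap.range L ≤ W) :
    finTrace L = LinearMap.trace ℂ W
      (L.restrict (p := W) (q := W) fun v _ => h (LinearMap.mem_range_self L v)) := by
  have : FiniteDimensional ℂ (LinearMap.range L) := Submodule.finiteDimensional_of_le h
  exact LinearMap.trace_comp_comm' (Submodule.inclusion h) (L.rangeRestrict ∘ₗ W.subtype)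

theorem range_add_le (L L' : Module.End ℂ V) :
    LinearMap.range (L + L') ≤ LinearMap.range L ⊔ LinearMap.range L' := by
  rintro _ ⟨v, rfl⟩
  exact Submodule.add_mem_sup (LinearMap.mem_range_self L v) (LinearMap.mem_range_self L' v)

theorem range_smul_le (c : ℂ) (L : Module.End ℂ V) :
    LinearMap.range (c • L) ≤ LinearMap.range L := by
  rintro _ ⟨v, rfl⟩
  exact Submodule.smul_mem _ c (LinearMap.mem_range_self L v)

theorem finTrace_add (L L' : Module.End ℂ V) [FiniteDimensional ℂ (LinearMap.range L)]
    [FiniteDimensional ℂ (LinearMap.range L')] :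
    finTrace (L + L') = finTrace L + finTrace L' := by
  rw [finTrace_eq_trace_restrict _ _ (range_add_le L L'),
    finTrace_eq_trace_restrict L (LinearMap.range L ⊔ LinearMap.range L') le_sup_left,
    finTrace_eq_trace_restrict L' (LinearMap.range L ⊔ LinearMap.range L') le_sup_right, ← map_add]
  rfl

theorem finTrace_smul (c : ℂ) (L : Module.End ℂ V) [FiniteDimensional ℂ (LinearMap.range L)] :
    finTrace (c • L) = c * finTrace L := by
  rw [finTrace_eq_trace_restrict _ _ (range_smul_le c L), ← smul_eq_mul, finTrace, ← map_smul]
  rfl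

/-- The trace of an operator whose image lies in the line of an eigenvector. -/
theorem finTrace_of_range_le_span (L : Module.End ℂ V) {v : V} (hv : v ≠ 0)
    (h : LinearMap.range L ≤ Submodule.span ℂ {v}) {c : ℂ} (hc : L v = c • v) :
    finTrace L = c := by
  rw [finTrace_eq_trace_restrict L _ h]
  have : L.restrict (p := Submodule.span ℂ {v}) (q := Submodule.span ℂ {v})
      (fun w _ => h (LinearMap.mem_range_self L w)) = c • LinearMap.id := by
    refine LinearMap.ext fun w => Subtype.ext ?_
    obtain ⟨w, hw⟩ := w
    obtain ⟨a, rfl⟩ := Submodule.mem_span_singleton.1 hw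
    simp [hc, smul_comm a c]
  rw [this, map_smul, LinearMap.trace_id, finrank_span_singleton hv]
  simp

end Trace

/-! ### Products with matrix units -/

theorem mulS_add_left (q : Set.Ioo (0 : ℝ) 1) (f f' : Series) {g : Series}
    (hg : g ∈ nilSub (sL q)) : mulS q (f + f') g = mulS q f g + mulS q f' g := by
  obtain ⟨N, hN⟩ := hg
  rw [mulS_eq q f g hN, mulS_eq q f' g hN, mulS_eq q _ g hN, ← Finset.sum_add_distrib]
  exact Finset.sum_congr rfl fun k _ => cv_add _ _ _

theorem mulS_smul_left (q : Set.Ioo (0 : ℝ) 1) (c : ℂ) (f : Series) {g : Series}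
    (hg : g ∈ nilSub (sL q)) : mulS q (c • f) g = c • mulS q f g := by
  obtain ⟨N, hN⟩ := hg
  rw [mulS_eq q f g hN, mulS_eq q _ g hN, Finset.smul_sum]
  refine Finset.sum_congr rfl fun k _ => ?_
  ext m n
  simp [cv, Finset.mul_sum, mul_assoc]

theorem mulS_zero_left (q : Set.Ioo (0 : ℝ) 1) (g : Series) : mulS q 0 g = 0 := by
  have : (fun k : ℕ => cv (fun j => (0 : Series) j k) ((sL q ^ k) g)) = fun _ => 0 :=
    funext fun k => cv_zero _
  rw [mulS, this, finsum_zero]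

theorem cv_upZ (f : Series) (k : ℕ) (g : Series) :
    cv (fun j => upZ f j k) g = zL (cv (fun j => f j k) g) := by
  ext m n
  rcases m with _ | m
  · simp [cv, zL]
  · simp [cv, zL, Finset.Nat.sum_antidiagonal_succ]

theorem mulS_zL (q : Set.Ioo (0 : ℝ) 1) (f : Series) {g : Series} (hg : g ∈ nilSub (sL q)) :
    mulS q (zL f) g = zL (mulS q f g) := by
  obtain ⟨N, hN⟩ := hg
  rw [mulS_eq q f g hN, mulS_eq q _ g hN, map_sum]
  exact Finset.sum_congr rfl fun k _ => cv_upZ f k _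

theorem mulS_sR (q : Set.Ioo (0 : ℝ) 1) (f : Series) {g : Series} (hg : g ∈ nilSub (sL q)) :
    mulS q (sR f) g = mulS q f (sL q g) := by
  obtain ⟨N, hN⟩ := hg
  have hN1 := pow_zero_of_le (Nat.le_succ N) hN
  have hN2 : (sL q ^ N) (sL q g) = 0 := by rwa [← Module.End.mul_apply, ← pow_succ]
  rw [mulS_eq q f _ hN2, mulS_eq q _ g hN1, Finset.sum_range_succ']
  -- A series `f z^*` has no term with `k = 0`, so the sum can be reindexed by `k + 1`.
  have h0 : (fun j => (sR f) j 0) = 0 := by ext j; simp [sR]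
  rw [h0, cv_zero, add_zero]
  refine Finset.sum_congr rfl fun k _ => ?_
  rw [pow_succ, Module.End.mul_apply]
  simp [sR]

/-- The first row of `f₀` is `1, 0, 0, …`, so only the summand `k = 0` reaches the constant
coefficient. -/
theorem mulS_apply_zero_zero (q : Set.Ioo (0 : ℝ) 1) {g : Series} (hg : g ∈ nilSub (sL q)) :
    mulS q (vac q) g 0 0 = g 0 0 := by
  obtain ⟨N, hN⟩ := hg
  rw [mulS_eq q _ g (pow_zero_of_le (Nat.le_succ N) hN), Finset.sum_apply, Finset.sum_apply,
    Finset.sum_range_succ']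
  simp [cv, vac, vacCoeff]

theorem mulS_vac (q : Set.Ioo (0 : ℝ) 1) {g : Series} (hg : g ∈ nilSub (sL q))
    (h : zR q g = 0) : mulS q (vac q) g = g 0 0 • vac q := by
  rw [← mulS_apply_zero_zero q hg]
  refine eq_smul_vac q ?_ ?_
  · rw [sL_mulS q _ hg, sL_vac, mulS_zero_left]
  · rw [zR_mulS q _ hg, h]
    simp [mulS]

/-- The factors `z^m` come out on the left and `z^{*n}` passes to `g`. What remains is `f₀` applied
to `z^{*n} g`, again killed by right multiplication by `z`, and this is a multiple of `f₀`. -/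
theorem mulS_matUnit (q : Set.Ioo (0 : ℝ) 1) (m n : ℕ) {g : Series} (hg : g ∈ nilSub (sL q))
    (h : zR q g = 0) : mulS q (matUnit q m n) g = ((sL q ^ n) g) 0 0 • matUnit q m 0 := by
  induction m, n using matUnit_induction generalizing g with
  | h0 => simpa [matUnit_zero_zero] using mulS_vac q hg h
  | hz m ih => rw [← zL_matUnit, mulS_zL q _ hg, ih hg h, map_smul, zL_matUnit]
  | hs m n ih =>
    rw [← sR_matUnit, mulS_sR q _ hg, ih (nilSub_apply_iff.2 hg) (by rw [zR_sL, h, map_zero]),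
      pow_succ, Module.End.mul_apply]

theorem sL_pow_matUnit_apply (q : Set.Ioo (0 : ℝ) 1) (m n : ℕ) :
    ((sL q ^ n) (matUnit q m 0)) 0 0 = if m = n then qfac q n else 0 := by
  induction n generalizing m with
  | zero =>
    rcases m with _ | m
    · simp [matUnit_zero_zero, vac_zero_zero, qfac]
    · rw [← zL_matUnit]
      simp [zL]
  | succ n ih =>
    rw [pow_succ, Module.End.mul_apply, sL_matUnit, map_smul]
    rcases m with _ | m
    · simp
    · by_cases h : m = n
      · subst h; simp [ih, qfac_succ, mul_comm]
      · simp [ih, h]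

/-! ### The functional `η` on matrix units -/

theorem Gtilde_Kinv_apply (q : Set.Ioo (0 : ℝ) 1) (h : Htilde q) :
    (Gtilde q (KinvB q) h : Series) = opKinv q h := by
  change ((actDU q (gen q UqGen.Kinv) (inclH q h) : DU q) : Series) = _
  rw [actDU_gen]
  rfl

theorem Ttilde_add (q : Set.Ioo (0 : ℝ) 1) (f g : DU q) :
    Ttilde q (f + g) = Ttilde q f + Ttilde q g :=
  LinearMap.ext fun h => Subtype.ext (mulS_add_left q f g (mem_DU.1 h.2.1).1)

theorem Ttilde_smul (q : Set.Ioo (0 : ℝ) 1) (c : ℂ) (f : DU q) :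
    Ttilde q (c • f) = c • Ttilde q f :=
  LinearMap.ext fun h => Subtype.ext (mulS_smul_left q c f (mem_DU.1 h.2.1).1)

theorem Ttilde_zero (q : Set.Ioo (0 : ℝ) 1) : Ttilde q 0 = 0 :=
  LinearMap.ext fun h => Subtype.ext (mulS_zero_left q h)

theorem matUnit_mem_Htilde (q : Set.Ioo (0 : ℝ) 1) (m : ℕ) : matUnit q m 0 ∈ Htilde q := by
  refine ⟨matUnit_mem q m 0, ?_⟩
  change zR q (matUnit q m 0) = 0
  rw [zR_matUnit]
  simp

/-- The basis vectors `z^m f₀` of `H̃`. -/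
def vecH (q : Set.Ioo (0 : ℝ) 1) (m : ℕ) : Htilde q := ⟨matUnit q m 0, matUnit_mem_Htilde q m⟩

theorem matUnit_apply_self (q : Set.Ioo (0 : ℝ) 1) (m : ℕ) : matUnit q m 0 m 0 = 1 := by
  induction m with
  | zero => exact vac_zero_zero q
  | succ m ih => rw [← zL_matUnit]; exact ih

theorem vecH_ne (q : Set.Ioo (0 : ℝ) 1) (m : ℕ) : vecH q m ≠ 0 := by
  intro h
  have := matUnit_apply_self q m
  rw [show matUnit q m 0 = 0 from congrArg Subtype.val h] at this
  simp at this

theorem Ttilde_unitDU_apply (q : Set.Ioo (0 : ℝ) 1) (m n : ℕ) (h : Htilde q) :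
    Ttilde q (unitDU q m n) h = ((sL q ^ n) (h : Series)) 0 0 • vecH q m :=
  Subtype.ext (mulS_matUnit q m n (mem_DU.1 h.2.1).1 h.2.2)

theorem range_unitDU_le (q : Set.Ioo (0 : ℝ) 1) (m n : ℕ) :
    LinearMap.range (Ttilde q (unitDU q m n) * Gtilde q (KinvB q)) ≤
      Submodule.span ℂ {vecH q m} := by
  rintro _ ⟨h, rfl⟩
  rw [Module.End.mul_apply, Ttilde_unitDU_apply]
  exact Submodule.smul_mem _ _ (Submodule.mem_span_singleton_self _)

/-- The trace is the eigenvalue on the only possible image vector `z^m f₀`: `K⁻¹` gives `q^{-2m}`,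
and the constant coefficient of `z^{*n} z^m f₀` gives the rest. -/
theorem eta_unitDU (q : Set.Ioo (0 : ℝ) 1) (m n : ℕ) :
    eta q (unitDU q m n) = if m = n then qfac q m * (qc q)⁻¹ ^ (2 * m) else 0 := by
  refine finTrace_of_range_le_span _ (vecH_ne q m) (range_unitDU_le q m n) ?_
  have hK : Gtilde q (KinvB q) (vecH q m) = (qc q)⁻¹ ^ (2 * m) • vecH q m := by
    refine Subtype.ext ?_
    have := opKinv_matUnit q m 0
    rw [mul_zero, pow_zero, mul_one] at this
    exact (Gtilde_Kinv_apply q _).trans this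
  rw [Module.End.mul_apply, hK, map_smul, Ttilde_unitDU_apply, smul_smul]
  congr 1
  change _ * ((sL q ^ n) (matUnit q m 0)) 0 0 = _
  rw [sL_pow_matUnit_apply]
  by_cases h : m = n
  · subst h; simp [mul_comm]
  · simp [h]

theorem finiteDimensional_range (q : Set.Ioo (0 : ℝ) 1) (f : DU q) :
    FiniteDimensional ℂ (LinearMap.range (Ttilde q f * Gtilde q (KinvB q))) := by
  induction f using DU_induction with
  | hu m n => exact Submodule.finiteDimensional_of_le (range_unitDU_le q m n)
  | h0 =>
    rw [Ttilde_zero, zero_mul, LinearMap.range_zero]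
    infer_instance
  | ha f g hf hg =>
    rw [Ttilde_add, add_mul]
    exact Submodule.finiteDimensional_of_le (range_add_le _ _)
  | hc c f hf =>
    rw [Ttilde_smul, smul_mul_assoc]
    exact Submodule.finiteDimensional_of_le (range_smul_le _ _)

theorem eta_add (q : Set.Ioo (0 : ℝ) 1) (f g : DU q) : eta q (f + g) = eta q f + eta q g := by
  have := finiteDimensional_range q f
  have := finiteDimensional_range q g
  rw [eta, Ttilde_add, add_mul, finTrace_add]
  rfl

theorem eta_smul (q : Set.Ioo (0 : ℝ) 1) (c : ℂ) (f : DU q) : eta q (c • f) = c * eta q f := by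
  have := finiteDimensional_range q f
  rw [eta, Ttilde_smul, smul_mul_assoc, finTrace_smul]
  rfl

/-- The functional `η` as a linear map. -/
def etaL (q : Set.Ioo (0 : ℝ) 1) : DU q →ₗ[ℂ] ℂ where
  toFun := eta q
  map_add' := eta_add q
  map_smul' := eta_smul q

theorem DU_linearMap_ext (q : Set.Ioo (0 : ℝ) 1) {φ ψ : DU q →ₗ[ℂ] ℂ}
    (h : ∀ m n, φ (unitDU q m n) = ψ (unitDU q m n)) : φ = ψ := by
  refine LinearMap.ext fun f => ?_
  induction f using DU_induction with
  | hu m n => exact h m n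
  | h0 => simp
  | ha f g hf hg => rw [map_add, map_add, hf, hg]
  | hc c f hf => rw [map_smul, map_smul, hf]

/-! ### Invariance -/

/-- `K` scales `e_{mn}` by `q^{2(m-n)}`, and `η` vanishes unless `m = n`. -/
theorem etaL_K (q : Set.Ioo (0 : ℝ) 1) : etaL q ∘ₗ genDU q UqGen.K = etaL q := by
  have h := qc_ne q
  refine DU_linearMap_ext q fun m n => ?_
  have : genDU q UqGen.K (unitDU q m n) =
      (qc q ^ (2 * m) * (qc q)⁻¹ ^ (2 * n)) • unitDU q m n :=
    Subtype.ext (opK_matUnit q m n)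
  rw [LinearMap.comp_apply, this, map_smul]
  change _ * eta q _ = eta q _
  rw [eta_unitDU]
  by_cases hmn : m = n
  · subst hmn
    simp [h]
  · simp [hmn]

theorem etaL_Kinv (q : Set.Ioo (0 : ℝ) 1) : etaL q ∘ₗ genDU q UqGen.Kinv = etaL q := by
  have h := qc_ne q
  refine DU_linearMap_ext q fun m n => ?_
  have : genDU q UqGen.Kinv (unitDU q m n) =
      ((qc q)⁻¹ ^ (2 * m) * qc q ^ (2 * n)) • unitDU q m n :=
    Subtype.ext (opKinv_matUnit q m n)
  rw [LinearMap.comp_apply, this, map_smul]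
  change _ * eta q _ = eta q _
  rw [eta_unitDU]
  by_cases hmn : m = n
  · subst hmn
    simp [h]
  · simp [hmn]

theorem etaL_E (q : Set.Ioo (0 : ℝ) 1) : etaL q ∘ₗ genDU q UqGen.E = 0 := by
  have h := one_sub_ne q
  have h1 := qh_ne q
  have h2 := qc_ne q
  refine DU_linearMap_ext q fun m n => ?_
  have : genDU q UqGen.E (unitDU q m n) =
      -(qh q / (1 - qc q ^ 2)) • unitDU q (m + 1) n +
        ((qh q ^ 3)⁻¹ * qc q ^ (2 * m) * brk ((qc q)⁻¹ ^ 2) n) • unitDU q m (n - 1) :=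
    Subtype.ext (opE_matUnit q m n)
  rw [LinearMap.comp_apply, this, map_add, map_smul, map_smul]
  change _ * eta q _ + _ * eta q _ = 0
  rw [eta_unitDU, eta_unitDU]
  rcases n with _ | n
  · simp
  -- Both terms vanish unless the original second index is `m + 1`. In that case the ratio `(1 -
  -- q^{2m+2}) q^{-2}` of consecutive values of `η` makes them cancel.
  · by_cases hmn : m = n
    · subst hmn
      have h3 : qc q ^ 2 = qh q ^ 4 := by rw [← qh_sq]; ring
      rw [if_pos rfl, Nat.add_sub_cancel, if_pos rfl, brk_neg, qfac_succ, inv_pow, inv_pow]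
      simp only [mul_add, pow_add, mul_one, pow_mul, h3] at h ⊢
      field_simp
      ring
    · simp [hmn]

theorem etaL_F (q : Set.Ioo (0 : ℝ) 1) : etaL q ∘ₗ genDU q UqGen.F = 0 := by
  have h := one_sub_ne q
  have h1 := qh_ne q
  have h2 := qc_ne q
  refine DU_linearMap_ext q fun m n => ?_
  have : genDU q UqGen.F (unitDU q m n) =
      -(qh q ^ 5 / (1 - qc q ^ 2)) • unitDU q m (n + 1) +
        (qh q * qc q ^ (2 * n) * brk ((qc q)⁻¹ ^ 2) m) • unitDU q (m - 1) n :=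
    Subtype.ext (opF_matUnit q m n)
  rw [LinearMap.comp_apply, this, map_add, map_smul, map_smul]
  change _ * eta q _ + _ * eta q _ = 0
  rw [eta_unitDU, eta_unitDU]
  rcases m with _ | m
  · simp
  · by_cases hmn : m = n
    · subst hmn
      have h3 : qc q ^ 2 = qh q ^ 4 := by rw [← qh_sq]; ring
      rw [if_pos rfl, Nat.add_sub_cancel, if_pos rfl, brk_neg, qfac_succ, inv_pow, inv_pow]
      simp only [mul_add, pow_add, mul_one, pow_mul, h3] at h ⊢
      field_simp
      ring
    · simp [hmn]

theorem counit_gen (q : Set.Ioo (0 : ℝ) 1) (g : UqGen) : counit q (gen q g) = match g with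
    | UqGen.K => 1
    | UqGen.Kinv => 1
    | UqGen.E => 0
    | UqGen.F => 0 := by
  cases g <;> simp [counit, gen]

theorem UqSl2_induction (q : Set.Ioo (0 : ℝ) 1) {p : UqSl2 q → Prop}
    (hg : ∀ g, p (gen q g)) (hc : ∀ r : ℂ, p (algebraMap ℂ _ r))
    (ha : ∀ a b, p a → p b → p (a + b)) (hm : ∀ a b, p a → p b → p (a * b)) (a : UqSl2 q) :
    p a := by
  obtain ⟨a, rfl⟩ := RingQuot.mkAlgHom_surjective ℂ (UqRel q) a
  induction a using FreeAlgebra.induction with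
  | grade0 r => rw [AlgHom.commutes]; exact hc r
  | grade1 g => exact hg g
  | mul a b iha ihb => rw [map_mul]; exact hm _ _ iha ihb
  | add a b iha ihb => rw [map_add]; exact ha _ _ iha ihb

theorem isInvariantIntegral_eta (q : Set.Ioo (0 : ℝ) 1) :
    IsInvariantIntegral (actDU q) (eta q) where
  linear := (etaL q).isLinear
  equivariant a := by
    -- The vector stays quantified: for a product `a b` the hypothesis on `a` is used at `b v`.
    change ∀ v, etaL q _ = _ * etaL q v
    induction a using UqSl2_induction with
    | hg g =>
      intro v
      rw [actDU_gen, counit_gen, ← LinearMap.comp_apply]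
      cases g
      · rw [etaL_K, one_mul]
      · rw [etaL_Kinv, one_mul]
      · rw [etaL_E, zero_mul]; rfl
      · rw [etaL_F, zero_mul]; rfl
    | hc r => intro v; simp
    | ha a b iha ihb => intro v; rw [map_add, map_add, LinearMap.add_apply, map_add, iha, ihb]; ring
    | hm a b iha ihb => intro v; rw [map_mul, map_mul, Module.End.mul_apply, iha, ihb]; ring

/-! ### The decomposition of finite functions -/

theorem zzVal_eq_zero (q : Set.Ioo (0 : ℝ) 1) {k n : ℕ} (h : n < k) : zzVal q k n = 0 := by
  refine Finset.prod_eq_zero (Finset.mem_range.2 h) ?_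
  rw [← mul_pow, inv_mul_cancel₀ (qc_ne q), one_pow, sub_self]

/-- The system is triangular with nonzero diagonal entries `zzVal q n n`. -/
theorem yCoeff_unique (q : Set.Ioo (0 : ℝ) 1) {φ c : ℕ → ℂ}
    (h : ∀ n, ∑ k ∈ Finset.range (n + 1), c k * zzVal q k n = φ n) : yCoeff q φ = c := by
  ext n
  induction n using Nat.strong_induction_on with
  | _ n ih =>
    have h1 := (yCoeff_spec q φ n).trans (h n).symm
    rw [Finset.sum_range_succ, Finset.sum_range_succ, Finset.sum_congr rfl
      fun k hk => by rw [ih k (Finset.mem_range.1 hk)]] at h1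
    exact mul_right_cancel₀ (zzVal_self_ne q n) (add_left_cancel h1)

theorem yCoeff_add (q : Set.Ioo (0 : ℝ) 1) (φ φ' : ℕ → ℂ) :
    yCoeff q (φ + φ') = yCoeff q φ + yCoeff q φ' :=
  yCoeff_unique q fun n => by
    simp only [Pi.add_apply, add_mul, Finset.sum_add_distrib, yCoeff_spec]

theorem yCoeff_smul (q : Set.Ioo (0 : ℝ) 1) (c : ℂ) (φ : ℕ → ℂ) :
    yCoeff q (c • φ) = c • yCoeff q φ :=
  yCoeff_unique q fun n => by
    simp only [Pi.smul_apply, smul_eq_mul, mul_assoc, ← Finset.mul_sum, yCoeff_spec]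

theorem yCoeff_zero (q : Set.Ioo (0 : ℝ) 1) : yCoeff q 0 = 0 :=
  yCoeff_unique q fun n => by simp

theorem yCoeff_injective (q : Set.Ioo (0 : ℝ) 1) : Function.Injective (yCoeff q) := by
  intro φ φ' h
  ext n
  rw [← yCoeff_spec q φ, h, yCoeff_spec]

theorem zL_pow_apply (f : Series) (i j k : ℕ) :
    (zL ^ i) f j k = if i ≤ j then f (j - i) k else 0 := by
  induction i generalizing j with
  | zero => simp
  | succ i ih =>
    rw [pow_succ', Module.End.mul_apply]
    rcases j with _ | j
    · rw [if_neg (by omega)]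
      rfl
    · simp only [Nat.add_le_add_iff_right, Nat.add_sub_add_right, ← ih]
      rfl

theorem sR_pow_apply (f : Series) (i j k : ℕ) :
    (sR ^ i) f j k = if i ≤ k then f j (k - i) else 0 := by
  induction i generalizing k with
  | zero => simp
  | succ i ih =>
    rw [pow_succ', Module.End.mul_apply]
    rcases k with _ | k
    · rw [if_neg (by omega)]
      exact upS_zero ((sR ^ i) f) j
    · simp only [Nat.add_le_add_iff_right, Nat.add_sub_add_right, ← ih]
      exact upS_succ ((sR ^ i) f) j k

/-- Each `ψ_i(y)` is supported on the main diagonal, and `z^i` or `z^{*|i|}` moves it to the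
diagonal `j - k = i`, where `min j k` is the position. Distinct components therefore never overlap.
-/
theorem ofParts_apply (q : Set.Ioo (0 : ℝ) 1) (ψ : ℤ →₀ ℕ →₀ ℂ) (j k : ℕ) :
    ofParts q ψ j k = yCoeff q (ψ (j - k)) (min j k) := by
  have key : ∀ i : ℤ, (if 0 ≤ i then (zL ^ i.toNat) (funY q (ψ i))
      else (sR ^ (-i).toNat) (funY q (ψ i))) j k =
      if i = (j : ℤ) - k then yCoeff q (ψ (j - k)) (min j k) else 0 := by
    intro i
    by_cases h0 : 0 ≤ i
    · rw [if_pos h0, zL_pow_apply, funY]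
      by_cases hi : i = (j : ℤ) - k
      · subst hi
        rw [if_pos (by omega), if_pos (by omega), if_pos rfl, min_eq_right (by omega)]
      · rw [if_neg hi]
        split_ifs with h1 h2
        · omega
        · rfl
        · rfl
    · rw [if_neg h0, sR_pow_apply, funY]
      by_cases hi : i = (j : ℤ) - k
      · subst hi
        rw [if_pos (by omega), if_pos (by omega), if_pos rfl]
        congr 1
        omega
      · rw [if_neg hi]
        split_ifs with h1 h2
        · omega
        · rfl
        · rfl
  rw [ofParts, Finset.sum_apply, Finset.sum_apply, Finset.sum_congr rfl fun i _ => key i,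
    Finset.sum_ite_eq']
  split_ifs with h
  · rfl
  · rw [Finsupp.notMem_support_iff.1 h, Finsupp.coe_zero, yCoeff_zero]
    rfl

theorem ofParts_injective (q : Set.Ioo (0 : ℝ) 1) : Function.Injective (ofParts q) := by
  intro ψ ψ' h
  ext i n
  refine congrFun (yCoeff_injective q (funext fun k => ?_)) n
  -- One of `i.toNat` and `(-i).toNat` is zero, so this is the `k`-th place on the diagonal `i`.
  have := congrFun (congrFun h (i.toNat + k)) ((-i).toNat + k)
  rw [ofParts_apply, ofParts_apply] at this
  have e1 : ((i.toNat + k : ℕ) : ℤ) - (((-i).toNat + k : ℕ) : ℤ) = i := by omega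
  have e2 : min (i.toNat + k) ((-i).toNat + k) = k := by omega
  rwa [e1, e2] at this

theorem ofParts_add (q : Set.Ioo (0 : ℝ) 1) (ψ ψ' : ℤ →₀ ℕ →₀ ℂ) :
    ofParts q (ψ + ψ') = ofParts q ψ + ofParts q ψ' := by
  ext j k
  simp [ofParts_apply, yCoeff_add]

theorem ofParts_smul (q : Set.Ioo (0 : ℝ) 1) (c : ℂ) (ψ : ℤ →₀ ℕ →₀ ℂ) :
    ofParts q (c • ψ) = c • ofParts q ψ := by
  ext j k
  simp [ofParts_apply, yCoeff_smul]

/-! ### Matrix units as functions supported at one point -/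

theorem zzVal_add (q : Set.Ioo (0 : ℝ) 1) (i p n : ℕ) :
    zzVal q (p + i) (p + n) = zzVal q p (p + n) * zzVal q i n := by
  have h := qc_ne q
  rw [zzVal, Finset.prod_range_add, zzVal, zzVal]
  congr 1
  refine Finset.prod_congr rfl fun t _ => ?_
  congr 1
  -- In the factor with index `p + t` the powers `q^{-2p}` and `q^{2p}` cancel.
  simp only [mul_add, pow_add, inv_pow]
  field_simp

theorem zzVal_self (q : Set.Ioo (0 : ℝ) 1) (n : ℕ) : zzVal q n n = qfac q n := by
  have h := qc_ne q
  rw [zzVal, qfac, ← Finset.prod_range_reflect]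
  refine Finset.prod_congr rfl fun i hi => ?_
  have hi := Finset.mem_range.1 hi
  congr 1
  rw [show 2 * n = 2 * (n - 1 - i) + 2 * (i + 1) by omega, pow_add, ← mul_assoc, ← mul_pow,
    inv_mul_cancel₀ h, one_pow, one_mul]

theorem zzVal_succ_succ (q : Set.Ioo (0 : ℝ) 1) (k n : ℕ) :
    zzVal q (k + 1) (n + 1) = (1 - qc q ^ (2 * (n + 1))) * zzVal q k n := by
  rw [add_comm k, add_comm n, zzVal_add]
  simp [zzVal]

/-- Partial sums of the alternating sum of Gaussian binomial coefficients. -/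
theorem sum_vacCoeff_mul_zzVal (q : Set.Ioo (0 : ℝ) 1) (M t : ℕ) :
    ∑ i ∈ Finset.range (t + 1), vacCoeff q i * zzVal q i (M + 1) =
      qc q ^ (2 * t) * vacCoeff q t * zzVal q t M := by
  induction t with
  | zero => simp [zzVal]
  | succ t ih =>
    have h := qc_ne q
    have h1 := one_sub_pow_ne q t
    rw [Finset.sum_range_succ, ih, zzVal_succ_succ, zzVal, zzVal, Finset.prod_range_succ, vacCoeff,
      inv_pow]
    simp only [mul_add, pow_add, mul_one] at h1 ⊢
    field_simp
    ring_nf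

/-- The right side lists the coefficients of `z^p f₀ z^{*p}`. Evaluated at `q^{2(p+n)}` they leave,
after the common factor `zzVal q p (p + n)`, the value of `f₀` at `q^{2n}`, which is `1` for `n = 0`
and `0` otherwise. -/
theorem yCoeff_single (q : Set.Ioo (0 : ℝ) 1) (p : ℕ) :
    yCoeff q (Finsupp.single p (qfac q p)) = fun k => if p ≤ k then vacCoeff q (k - p) else 0 := by
  refine yCoeff_unique q fun n => ?_
  by_cases hp : p ≤ n
  · obtain ⟨n, rfl⟩ := Nat.exists_eq_add_of_le hp
    rw [add_assoc, Finset.sum_range_add]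
    rw [Finset.sum_eq_zero fun k hk => by
      rw [if_neg (not_le.2 (Finset.mem_range.1 hk)), zero_mul], zero_add]
    simp only [zzVal_add, Nat.le_add_right, if_true, Nat.add_sub_cancel_left]
    rcases n with _ | n
    · simp [vacCoeff, zzVal_self, qfac]
    · simp only [mul_left_comm _ (zzVal q p _), ← Finset.mul_sum]
      -- The sum is complete here, and its closed form contains the vanishing factor `zzVal q (n +
      -- 1) n`.
      rw [sum_vacCoeff_mul_zzVal, zzVal_eq_zero q (Nat.lt_succ_self n)]
      simp
  · rw [Finset.sum_eq_zero fun k hk => by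
      rw [if_neg (by have := Finset.mem_range.1 hk; omega), zero_mul]]
    rw [Finsupp.single_eq_of_ne (by omega)]

theorem matUnit_eq_ofParts (q : Set.Ioo (0 : ℝ) 1) (m n : ℕ) : matUnit q m n =
    ofParts q (Finsupp.single ((m : ℤ) - n)
      (Finsupp.single (min m n) (qfac q (min m n)))) := by
  ext j k
  rw [ofParts_apply, matUnit, sR_pow_apply, zL_pow_apply, vac]
  by_cases h : (m : ℤ) - n = j - k
  · rw [h, Finsupp.single_eq_same, yCoeff_single]
    beta_reduce
    have h1 : n ≤ k ↔ min m n ≤ min j k := by omega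
    have h2 : n ≤ k → m ≤ j := by omega
    by_cases h3 : n ≤ k
    · rw [if_pos h3, if_pos (h2 h3), if_pos (h1.1 h3), if_pos (by omega)]
      congr 1
      omega
    · rw [if_neg h3, if_neg (fun h4 => h3 (h1.2 h4))]
  · rw [Finsupp.single_eq_of_ne (Ne.symm h), Finsupp.coe_zero, yCoeff_zero]
    split_ifs with h1 h2 h3
    · omega
    · rfl
    · rfl
    · rfl

theorem exists_eq_ofParts (q : Set.Ioo (0 : ℝ) 1) (f : DU q) :
    ∃ ψ, (f : Series) = ofParts q ψ := by
  induction f using DU_induction with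
  | hu m n => exact ⟨_, matUnit_eq_ofParts q m n⟩
  | h0 => exact ⟨0, by simp [ofParts]⟩
  | ha f g hf hg =>
    obtain ⟨ψ, hψ⟩ := hf
    obtain ⟨ψ', hψ'⟩ := hg
    exact ⟨ψ + ψ', by rw [ofParts_add, ← hψ, ← hψ']; rfl⟩
  | hc c f hf =>
    obtain ⟨ψ, hψ⟩ := hf
    exact ⟨c • ψ, by rw [ofParts_smul, ← hψ]; rfl⟩

/-! ### Comparison of the integral with `η` -/

theorem ofParts_parts (q : Set.Ioo (0 : ℝ) 1) (f : DU q) : ofParts q (parts q f) = f := by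
  have h := exists_eq_ofParts q f
  rw [parts, dif_pos h]
  exact h.choose_spec.symm

/-- The components of a finite function, as a linear map. -/
def partsL (q : Set.Ioo (0 : ℝ) 1) : DU q →ₗ[ℂ] ℤ →₀ ℕ →₀ ℂ where
  toFun f := parts q f
  -- The components are defined by choice, so linearity comes from uniqueness of the decomposition.
  map_add' f g := ofParts_injective q <| by
    rw [ofParts_add, ofParts_parts, ofParts_parts, ofParts_parts]; rfl
  map_smul' c f := ofParts_injective q <| by
    rw [RingHom.id_apply, ofParts_smul, ofParts_parts, ofParts_parts]; rfl

/-- The integral over the quantum disc as a linear map. -/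
def nuL (q : Set.Ioo (0 : ℝ) 1) : DU q →ₗ[ℂ] ℂ :=
  (1 - qc q ^ 2) • (Finsupp.lsum ℂ fun n => LinearMap.mulRight ℂ ((qc q)⁻¹ ^ (2 * n))) ∘ₗ
    Finsupp.lapply 0 ∘ₗ partsL q

theorem nuL_apply (q : Set.Ioo (0 : ℝ) 1) (f : DU q) : nuL q f = nuIntegral q f := rfl

theorem parts_unitDU (q : Set.Ioo (0 : ℝ) 1) (m n : ℕ) : parts q (unitDU q m n) =
    Finsupp.single ((m : ℤ) - n) (Finsupp.single (min m n) (qfac q (min m n))) :=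
  ofParts_injective q <| (ofParts_parts q _).trans (matUnit_eq_ofParts q m n)

/-- On `e_{mm}` the only value of `ψ_0` sits at `q^{2m}`, and its weight `q^{-2m}` is exactly the
eigenvalue of `K⁻¹` in `eta_unitDU`. For `m ≠ n` both sides vanish. -/
theorem nuL_eq (q : Set.Ioo (0 : ℝ) 1) : nuL q = (1 - qc q ^ 2) • etaL q := by
  refine DU_linearMap_ext q fun m n => ?_
  rw [nuL_apply, nuIntegral, parts_unitDU, LinearMap.smul_apply, smul_eq_mul]
  congr 1
  change _ = eta q _
  rw [eta_unitDU]
  by_cases h : m = n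
  · subst h
    simp
  · rw [Finsupp.single_eq_of_ne (by omega), if_neg h, Finsupp.sum_zero_index]

theorem nuIntegral_eq (q : Set.Ioo (0 : ℝ) 1) (f : DU q) :
    nuIntegral q f = (1 - qc q ^ 2) * eta q f := by
  rw [← nuL_apply, nuL_eq]
  rfl

theorem isInvariantIntegral_nuIntegral (q : Set.Ioo (0 : ℝ) 1) :
    IsInvariantIntegral (actDU q) (nuIntegral q) where
  linear := (nuL q).isLinear
  equivariant a v := by
    rw [nuIntegral_eq, nuIntegral_eq, (isInvariantIntegral_eta q).equivariant]
    ring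

end QDisc
end

theorem theorem3p5 (q : Set.Ioo (0 : ℝ) 1) :
    -- the trace is that of operators of finite rank, and `η` is an invariant integral
    (∀ f : DU q, FiniteDimensional ℂ (LinearMap.range (Ttilde q f * Gtilde q (KinvB q)))) ∧
    IsInvariantIntegral (actDU q) (eta q) ∧
    -- the decomposition that defines `∫ f dν` exists and is unique
    (∀ f : DU q, ∃! ψ : ℤ →₀ ℕ →₀ ℂ, (f : Series) = ofParts q ψ) ∧
    -- `∫ f dν` is a nonzero multiple of `η`, and an invariant integral
    (∃ c : ℂ, c ≠ 0 ∧ ∀ f : DU q, nuIntegral q f = c * eta q f) ∧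
    IsInvariantIntegral (actDU q) (nuIntegral q) := by
  refine ⟨finiteDimensional_range q, isInvariantIntegral_eta q, fun f => ?_,
    ⟨1 - qc q ^ 2, one_sub_ne q, nuIntegral_eq q⟩, isInvariantIntegral_nuIntegral q⟩
  obtain ⟨ψ, hψ⟩ := exists_eq_ofParts q f
  exact ⟨ψ, hψ, fun ψ' h' => ofParts_injective q (h'.symm.trans hψ)⟩
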